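/- Let $x=(x_1,x_2,x_3,\dots)$, $y=(y_1,y_2,y_3,\dots)$, put $\xi(t,k)=\sum_{m\ge 1}t_mk^m$ and $[\alpha]=(\alpha,\alpha^2/2,\alpha^3/3,\dots)$. Define polynomials $p_k(x)$ by $e^{\xi(x,z)}=\sum_{k\ge 0}p_k(x)z^k$ and $p_k=0$ for $k<0$, and for a partition $\lambda=(\lambda_1,\dots,\lambda_n)$ the Schur function $\chi_\lambda(x)=\det\big(p_{\lambda_i-i+j}(x)\big)_{1\le i,j\le n}$. A partition is written in Frobenius notation as $(k_1,\dots,k_n\,|\,l_1,\dots,l_n)$ with $k_1>\dots>k_n\ge 0$ and $l_1>\dots>l_n\ge 0$, where $n$ is the number of diagonal cells of its Young diagram and $k_i$ and $l_i$ are the numbers of cells to the right of and below the $i$-th diagonal cell. A formal power series $\tau(x)\in\mathbb{C}[[x_1,x_2,\dots]]$ is called a solution of the KP hierarchy if, identically in $x$ and $y$, $$\oint e^{-2\xi(y,k)}\,\tau(x-y-[k^{-1}])\,\tau(x+y+[k^{-1}])\,\frac{dk}{2\pi i}=0,$$ where the integral denotes the coefficient of $k^{-1}$ in the formal expansion of the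 integrand in powers of $k$. **Theorem.** Let $\tau(x)\in\mathbb{C}[[x_1,x_2,\dots]]$ be a formal power series with $\tau(0)=1$. Then $\tau$ has a unique expansion $\tau(x)=\sum_\lambda \xi_\lambda\chi_\lambda(x)$ with $\xi_\lambda\in\mathbb{C}$, the sum running over all partitions, and $\tau$ is a solution of the KP hierarchy if and only if $$\xi_{(k_1,\dots,k_n|l_1,\dots,l_n)}=\det\big(\xi_{(k_i|l_j)}\big)_{1\le i,j\le n}$$ for every partition $(k_1,\dots,k_n\,|\,l_1,\dots,l_n)$. -/

import Mathlib

open scoped MvPowerSeries.WithPiTopology PowerSeries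

noncomputable section

/-!
Conventions.  The variables `x₁, x₂, x₃, …` are indexed from zero: `MvPowerSeries ℕ ℂ` is the ring
`ℂ⟦x₁, x₂, …⟧` of formal power series in countably many variables, with `X m` standing for
`x_{m+1}`.  Infinite sums of formal power series are sums in the topology of coefficientwise
convergence (a monomial occurs in only finitely many terms of each of the sums below).
-/

namespace KP

/-! ### Exponential generating series and Schur polynomials -/

/-- The power series `ξ(t, k) = ∑_{m ≥ 1} t_m k^m` in `k`; the entry `t m` is `t_{m+1}`. -/
def xi {R : Type*} [CommRing R] (t : ℕ → R) : R⟦X⟧ :=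
  PowerSeries.mk fun
    | 0 => 0
    | m + 1 => t m

/-- The exponential `e^f = ∑_n fⁿ / n!` of a power series `f` without constant term. -/
def expSeries {R : Type*} [CommRing R] [Algebra ℂ R] (f : R⟦X⟧) : R⟦X⟧ :=
  (PowerSeries.exp ℂ).subst f

/-- The polynomials `p_k(x)`, where `e^{∑_{m ≥ 1} x_m z^m} = ∑_{k ≥ 0} p_k(x) z^k`,
and `p_k = 0` for `k < 0`. -/
def p : ℤ → MvPolynomial ℕ ℂ
  | Int.ofNat k => PowerSeries.coeff k (expSeries (xi fun m => (MvPolynomial.X m : MvPolynomial ℕ ℂ)))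
  | Int.negSucc _ => 0

/-- The Schur function `χ_λ(x) = det (p_{λ_i - i + j}(x))_{1 ≤ i, j ≤ n}`, where
`λ = (λ_1, …, λ_n)` is a partition with `n` (nonzero) parts, given by its Young diagram. -/
def schur (lam : YoungDiagram) : MvPolynomial ℕ ℂ :=
  Matrix.det (Matrix.of fun i j : Fin (lam.colLen 0) =>
    p ((lam.rowLen i : ℤ) - (i : ℤ) + (j : ℤ)))

/-- `τ = ∑_λ ξ_λ χ_λ`, the sum being over all partitions. -/
def IsSchurExpansion (τ : MvPowerSeries ℕ ℂ) (c : YoungDiagram → ℂ) : Prop :=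
  HasSum (fun lam : YoungDiagram => c lam • (schur lam : MvPowerSeries ℕ ℂ)) τ

/-! ### Frobenius notation -/

/-- The partition `(k_1, …, k_n | l_1, …, l_n)` in Frobenius notation, where
`k_1 > ⋯ > k_n ≥ 0` and `l_1 > ⋯ > l_n ≥ 0`: its Young diagram has `n` cells on the main diagonal,
with `k_i` cells to the right of the `i`-th one (in the same row) and `l_i` cells below it
(in the same column). -/
def frobenius {n : ℕ} (k l : Fin n → ℕ) (hk : StrictAnti k) (hl : StrictAnti l) :
    YoungDiagram where
  cells := Finset.univ.biUnion fun i : Fin n =>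
    (Finset.range (k i + 1)).image (fun s => ((i : ℕ), (i : ℕ) + s)) ∪
      (Finset.range (l i + 1)).image (fun s => ((i : ℕ) + s, (i : ℕ)))
  isLowerSet := by
    have key : ∀ f : Fin n → ℕ, StrictAnti f → ∀ (d : ℕ) (i j : Fin n),
        (j : ℕ) = i + d → f j + d ≤ f i := by
      intro f hf d
      induction d with
      | zero =>
        intro i j h
        have : j = i := Fin.ext (by omega)
        simp [this]
      | succ d ih =>
        intro i j h
        have hlt : (i : ℕ) + d < n := by have := j.2; omega
        have h1 := ih i ⟨i + d, hlt⟩ rfl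
        have h2 := hf (show (⟨i + d, hlt⟩ : Fin n) < j from Fin.lt_def.2 (by simp; omega))
        omega
    rintro ⟨a, b⟩ ⟨a', b'⟩ hle hmem
    obtain ⟨h1, h2⟩ : a' ≤ a ∧ b' ≤ b := hle
    simp only [Finset.coe_biUnion, Finset.coe_union, Finset.coe_image, Set.mem_iUnion,
      Set.mem_union, Set.mem_image, Finset.mem_coe, Finset.mem_range, Prod.mk.injEq,
      Finset.mem_univ, exists_true_left] at hmem ⊢
    have hmin : ∃ i : Fin n, (i : ℕ) = min a b ∧ a ≤ i + l i ∧ b ≤ i + k i := by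
      obtain ⟨i, ⟨s, hs, rfl, rfl⟩ | ⟨s, hs, rfl, rfl⟩⟩ := hmem
      · exact ⟨i, by omega, by omega, by omega⟩
      · exact ⟨i, by omega, by omega, by omega⟩
    obtain ⟨i, hi, ha, hb⟩ := hmin
    have hj : min a' b' < n := by have := i.2; omega
    have hkj := key k hk (i - min a' b') ⟨min a' b', hj⟩ i (by simp; omega)
    have hlj := key l hl (i - min a' b') ⟨min a' b', hj⟩ i (by simp; omega)
    refine ⟨⟨min a' b', hj⟩, ?_⟩
    rcases le_total a' b' with h | h
    · exact Or.inl ⟨b' - a', by omega, by simp; omega, by simp; omega⟩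
    · exact Or.inr ⟨a' - b', by omega, by simp; omega, by simp; omega⟩

/-- The hook partition `(a | b) = (a + 1, 1, …, 1)` (with `b` ones), in Frobenius notation. -/
def hook (a b : ℕ) : YoungDiagram :=
  frobenius (n := 1) (fun _ => a) (fun _ => b) (Subsingleton.strictAnti _)
    (Subsingleton.strictAnti _)

/-- The Giambelli type formula
`ξ_{(k_1, …, k_n | l_1, …, l_n)} = det (ξ_{(k_i | l_j)})_{1 ≤ i, j ≤ n}` for all partitions. -/
def IsGiambelli (c : YoungDiagram → ℂ) : Prop :=
  ∀ (n : ℕ) (k l : Fin n → ℕ) (hk : StrictAnti k) (hl : StrictAnti l),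
    c (frobenius k l hk hl) = Matrix.det (Matrix.of fun i j : Fin n => c (hook (k i) (l j)))

/-! ### The KP hierarchy -/

/-- The variables `x_m`, `y_m` (`m ≥ 1`) and `z`; the last one stands for `k⁻¹`. -/
abbrev Var : Type := Option (ℕ ⊕ ℕ)

/-- `x_{m+1}` as an element of `ℂ⟦x, y, z⟧`. -/
def x (m : ℕ) : MvPowerSeries Var ℂ := MvPowerSeries.X (some (Sum.inl m))

/-- `y_{m+1}` as an element of `ℂ⟦x, y, z⟧`. -/
def y (m : ℕ) : MvPowerSeries Var ℂ := MvPowerSeries.X (some (Sum.inr m))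

/-- The entry `z^{m+1} / (m+1)` of `[z] = (z, z²/2, z³/3, …)`, in `ℂ⟦x, y, z⟧`. -/
def br (m : ℕ) : MvPowerSeries Var ℂ :=
  ((m + 1 : ℂ)⁻¹) • (MvPowerSeries.X none : MvPowerSeries Var ℂ) ^ (m + 1)

/-- The formal power series `τ(x - y - [z])` in `x`, `y`, `z`. -/
def tauMinus (τ : MvPowerSeries ℕ ℂ) : MvPowerSeries Var ℂ :=
  τ.subst fun m => x m - y m - br m

/-- The formal power series `τ(x + y + [z])` in `x`, `y`, `z`. -/
def tauPlus (τ : MvPowerSeries ℕ ℂ) : MvPowerSeries Var ℂ :=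
  τ.subst fun m => x m + y m + br m

/-- The product `τ(x - y - [k⁻¹]) τ(x + y + [k⁻¹])`, as a power series in `z = k⁻¹` with
coefficients in `ℂ⟦x, y⟧`. -/
def tauProd (τ : MvPowerSeries ℕ ℂ) : (MvPowerSeries (ℕ ⊕ ℕ) ℂ)⟦X⟧ :=
  MvPowerSeries.optionEquivLeft (ℕ ⊕ ℕ) ℂ (tauMinus τ * tauPlus τ)

/-- `e^{-2 ξ(y, k)}`, as a power series in `k` with coefficients in `ℂ⟦x, y⟧`. -/
def expFactor : (MvPowerSeries (ℕ ⊕ ℕ) ℂ)⟦X⟧ :=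
  expSeries (-2 * xi fun m => (MvPowerSeries.X (Sum.inr m) : MvPowerSeries (ℕ ⊕ ℕ) ℂ))

/-- `HasLaurentCoeff A B j c`: the coefficient of `k^j` in `A(k) B(k⁻¹)` is `c`, that is,
`∑_{a, b ≥ 0, a - b = j} A_a B_b = c`. -/
def HasLaurentCoeff (A B : (MvPowerSeries (ℕ ⊕ ℕ) ℂ)⟦X⟧) (j : ℤ)
    (c : MvPowerSeries (ℕ ⊕ ℕ) ℂ) : Prop :=
  HasSum (fun s : {s : ℕ × ℕ // (s.1 : ℤ) - (s.2 : ℤ) = j} =>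
    PowerSeries.coeff s.1.1 A * PowerSeries.coeff s.1.2 B) c

/-- `τ` is a solution of the KP hierarchy:
`∮ e^{-2 ξ(y, k)} τ(x - y - [k⁻¹]) τ(x + y + [k⁻¹]) dk / (2 π i) = 0` identically in `x` and `y`,
where the integral is the coefficient of `k⁻¹` in the expansion of the integrand. -/
def IsKPSolution (τ : MvPowerSeries ℕ ℂ) : Prop :=
  HasLaurentCoeff expFactor (tauProd τ) (-1) 0

end KP

end

noncomputable section

namespace KP

/-! ### Exponentials of power series -/

section Xi

variable {A : Type*} [CommRing A]

/-! The bilinear identity says that the coefficients `c` of the Schur expansion are Plücker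
coordinates. For `τ(0) = 1`, the Giambelli formula describes the coordinates on the corresponding
affine chart.

Put `u = x - y` and `v = x + y`, so that the exponential factor becomes `e^{ξ(u - v, k)}`. Encode a
partition by the strictly decreasing tuple of its levels `λ_i + (M - 1 - i)`; its Schur function is
then the determinant `jdet` of that tuple. Shifting the variables by `[z]` acts on the generating
series of the `p_k` as division by `1 - zX`. Column operations therefore give `hasSum_residue`: the
residue for a pair of tuples `(t, t')` is the signed sum over all ways of moving one level from `t'`
to `t`. Summing over the expansion of `τ` and collecting terms (`sum_bilin_eq`) turns the identity
into the vanishing of `∑ pluckerSum c α β · χ_α(u) χ_β(v)`. Products of Schur functions in `u` and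
`v` are linearly independent, so the identity amounts to quadratic Plücker relations for `c`.
Everything is graded: in each weight only finitely many partitions occur, and they fit into a fixed
number of rows.

From KP to Giambelli, take for `α` the levels of the empty partition with `N + 1 + k_1` added, and
for `β` the levels of `(k | l)` with the largest one removed. This single relation is the expansion
of the Giambelli determinant along its first row (`eq_sum_removeHook`), and induction on the number
of diagonal cells finishes.

Conversely, form a matrix whose rows are unit vectors at the levels of the empty partition and
signed hook coefficients at higher levels (`giambelliRow`). Its maximal minors satisfy the same
first row expansion, hence equal `c` (`diag_eq_rowDet`), and maximal minors satisfy all Plücker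
relations (`pluckerSum_rowDet`).

Existence and uniqueness of the expansion hold because the Schur functions of weight `w` form a
basis of the polynomials of weight `w`. -/

theorem constantCoeff_xi (t : ℕ → A) : PowerSeries.constantCoeff (xi t) = 0 := by
  rw [← PowerSeries.coeff_zero_eq_constantCoeff_apply]
  simp [xi]

theorem coeff_succ_xi (t : ℕ → A) (n : ℕ) : PowerSeries.coeff (n + 1) (xi t) = t n := by
  simp [xi]

theorem xi_add (s t : ℕ → A) : xi (s + t) = xi s + xi t := by
  ext n
  cases n <;> simp [xi]

/-- The coefficient of `X ^ k` in a power series, extended by zero to `k < 0`. -/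
def zcoeff (F : A⟦X⟧) (k : ℤ) : A :=
  if 0 ≤ k then PowerSeries.coeff k.toNat F else 0

theorem zcoeff_natCast (F : A⟦X⟧) (k : ℕ) : zcoeff F k = PowerSeries.coeff k F := by
  simp [zcoeff]

theorem zcoeff_of_neg (F : A⟦X⟧) {k : ℤ} (hk : k < 0) : zcoeff F k = 0 := by
  simp [zcoeff, hk]

theorem zcoeff_mul (F G : A⟦X⟧) (k : ℤ) :
    zcoeff (F * G) k = ∑ a ∈ Finset.range (k.toNat + 1), PowerSeries.coeff a F * zcoeff G (k - a) := by
  rcases lt_or_ge k 0 with hk | hk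
  · rw [zcoeff_of_neg _ hk]
    refine (Finset.sum_eq_zero fun a _ => ?_).symm
    rw [zcoeff_of_neg _ (by omega), mul_zero]
  · lift k to ℕ using hk
    rw [zcoeff_natCast, PowerSeries.coeff_mul, Finset.Nat.sum_antidiagonal_eq_sum_range_succ_mk]
    refine Finset.sum_congr rfl fun a ha => ?_
    rw [Int.toNat_natCast, Finset.mem_range] at ha
    rw [← Nat.cast_sub (by omega), zcoeff_natCast]

theorem zcoeff_mul_eq_sum_range (F G : A⟦X⟧) (k : ℤ) {B : ℕ} (hB : k < B) :
    zcoeff (F * G) k = ∑ a ∈ Finset.range B, PowerSeries.coeff a F * zcoeff G (k - a) := by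
  rw [zcoeff_mul]
  rcases lt_or_ge k 0 with hk | hk
  · rw [Finset.sum_eq_zero, Finset.sum_eq_zero] <;>
    · intro a _
      rw [zcoeff_of_neg _ (by omega), mul_zero]
  · refine Finset.sum_subset (Finset.range_mono (by omega)) fun a _ ha => ?_
    rw [Finset.mem_range] at ha
    rw [zcoeff_of_neg _ (by omega), mul_zero]

theorem zcoeff_one_sub_mul (c : A) (F : A⟦X⟧) (k : ℤ) :
    zcoeff ((1 - PowerSeries.C c * PowerSeries.X) * F) k = zcoeff F k - c * zcoeff F (k - 1) := by
  rcases lt_trichotomy k 0 with hk | rfl | hk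
  · rw [zcoeff_of_neg _ hk, zcoeff_of_neg _ hk, zcoeff_of_neg _ (by omega)]
    simp
  · rw [zcoeff_of_neg F (show (0 : ℤ) - 1 < 0 by omega)]
    simp [zcoeff]
  · obtain ⟨n, rfl⟩ : ∃ n : ℕ, k = (n + 1 : ℕ) := ⟨(k - 1).toNat, by omega⟩
    rw [show ((n + 1 : ℕ) : ℤ) - 1 = (n : ℕ) by push_cast; ring, zcoeff_natCast, zcoeff_natCast,
      zcoeff_natCast, sub_mul, one_mul, map_sub, mul_assoc, PowerSeries.coeff_C_mul,
      PowerSeries.coeff_succ_X_mul]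

end Xi

/-! ### Exponentials over a `ℂ`-algebra, values of `p_k`, and the shift by `[z]` -/

section Exponential

variable {A : Type*} [CommRing A] [Algebra ℂ A]

theorem expSeries_eq_subst_exp [Algebra ℚ A] {f : A⟦X⟧} (hf : PowerSeries.constantCoeff f = 0) :
    expSeries f = (PowerSeries.exp A).subst f := by
  have hs := PowerSeries.HasSubst.of_constantCoeff_zero' hf
  ext n
  rw [expSeries, PowerSeries.coeff_subst' hs, PowerSeries.coeff_subst' hs]
  refine finsum_congr fun d => ?_
  have h : algebraMap ℚ A = (algebraMap ℂ A).comp (algebraMap ℚ ℂ) := Subsingleton.elim _ _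
  rw [PowerSeries.coeff_exp, PowerSeries.coeff_exp, smul_eq_mul, Algebra.smul_def, h]
  rfl

theorem constantCoeff_expSeries {f : A⟦X⟧} (hf : PowerSeries.constantCoeff f = 0) :
    PowerSeries.constantCoeff (expSeries f) = 1 := by
  have hs := PowerSeries.HasSubst.of_constantCoeff_zero' hf
  rw [← PowerSeries.coeff_zero_eq_constantCoeff_apply, expSeries, PowerSeries.coeff_subst' hs,
    finsum_eq_single _ 0]
  · simp
  · intro n hn
    simp [hf, hn]

theorem derivative_expSeries {f : A⟦X⟧} (hf : PowerSeries.constantCoeff f = 0) :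
    PowerSeries.derivative A (expSeries f) = PowerSeries.derivative A f * expSeries f := by
  -- Restricting scalars from `ℂ` lets the exponential be taken over `A` itself, where the chain
  -- rule for substitution applies.
  let _ : Algebra ℚ A := Algebra.compHom A (algebraMap ℚ ℂ)
  rw [expSeries_eq_subst_exp hf, PowerSeries.derivative_subst (PowerSeries.HasSubst.of_constantCoeff_zero' hf),
    PowerSeries.derivative_exp, mul_comm]

theorem isUnit_natCast_succ (n : ℕ) : IsUnit ((n : A) + 1) := by
  have h : IsUnit (algebraMap ℂ A ((n : ℂ) + 1)) :=
    (isUnit_iff_ne_zero.2 (Nat.cast_add_one_ne_zero n)).map _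
  simpa using h

/-- The equation `F' = gF` determines each coefficient from the earlier ones, because `n + 1` is
invertible. This uniqueness yields all the identities for exponentials below. -/
theorem eq_of_derivative_eq_mul {F G g : A⟦X⟧}
    (hc : PowerSeries.constantCoeff F = PowerSeries.constantCoeff G)
    (hF : PowerSeries.derivative A F = g * F) (hG : PowerSeries.derivative A G = g * G) :
    F = G := by
  ext n
  induction n using Nat.strong_induction_on with
  | _ n ih =>
    cases n with
    | zero => simpa using hc
    | succ n =>
      have h1 := congrArg (PowerSeries.coeff n) hF
      have h2 := congrArg (PowerSeries.coeff n) hG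
      rw [PowerSeries.coeff_derivative] at h1 h2
      refine (isUnit_natCast_succ n).mul_right_cancel ?_
      rw [h1, h2, PowerSeries.coeff_mul, PowerSeries.coeff_mul]
      refine Finset.sum_congr rfl fun x hx => ?_
      rw [ih x.2 (by have := Finset.HasAntidiagonal.mem_antidiagonal.1 hx; omega)]

theorem expSeries_add {f g : A⟦X⟧} (hf : PowerSeries.constantCoeff f = 0)
    (hg : PowerSeries.constantCoeff g = 0) : expSeries (f + g) = expSeries f * expSeries g := by
  have hfg : PowerSeries.constantCoeff (f + g) = 0 := by simp [hf, hg]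
  refine eq_of_derivative_eq_mul (g := PowerSeries.derivative A (f + g)) ?_
    (derivative_expSeries hfg) ?_
  · simp [constantCoeff_expSeries, hf, hg]
  · rw [Derivation.leibniz, derivative_expSeries hf, derivative_expSeries hg, map_add]
    simp only [smul_eq_mul]
    ring

theorem map_expSeries {B : Type*} [CommRing B] [Algebra ℂ B] (φ : A →ₐ[ℂ] B) {f : A⟦X⟧}
    (hf : PowerSeries.constantCoeff f = 0) :
    PowerSeries.map (φ : A →+* B) (expSeries f) = expSeries (PowerSeries.map (φ : A →+* B) f) := by
  have hf' : PowerSeries.constantCoeff (PowerSeries.map (φ : A →+* B) f) = 0 := by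
    simp [← PowerSeries.coeff_zero_eq_constantCoeff_apply, PowerSeries.coeff_map, hf]
  have hd : ∀ F : A⟦X⟧, PowerSeries.derivative B (PowerSeries.map (φ : A →+* B) F) =
      PowerSeries.map (φ : A →+* B) (PowerSeries.derivative A F) := by
    intro F
    ext n
    simp [PowerSeries.coeff_derivative]
  refine eq_of_derivative_eq_mul (g := PowerSeries.derivative B (PowerSeries.map (φ : A →+* B) f))
    ?_ ?_ (derivative_expSeries hf')
  · rw [constantCoeff_expSeries hf', ← PowerSeries.coeff_zero_eq_constantCoeff_apply,
      PowerSeries.coeff_map, PowerSeries.coeff_zero_eq_constantCoeff_apply,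
      constantCoeff_expSeries hf, map_one]
  · rw [hd, hd, derivative_expSeries hf, map_mul]

/-- The series `e^{ξ(t, z)}`. -/
def expXi (t : ℕ → A) : A⟦X⟧ := expSeries (xi t)

/-- The value of `p_k` at `x = t`. -/
def hval (t : ℕ → A) (k : ℤ) : A := zcoeff (expXi t) k

theorem expXi_add (s t : ℕ → A) : expXi (s + t) = expXi s * expXi t := by
  rw [expXi, xi_add, expSeries_add (constantCoeff_xi s) (constantCoeff_xi t)]
  rfl

theorem hval_zero (t : ℕ → A) : hval t 0 = 1 := by
  simp [hval, zcoeff, expXi, constantCoeff_expSeries (constantCoeff_xi t)]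

theorem hval_of_neg (t : ℕ → A) {k : ℤ} (hk : k < 0) : hval t k = 0 := zcoeff_of_neg _ hk

theorem map_hval {B : Type*} [CommRing B] [Algebra ℂ B] (φ : A →ₐ[ℂ] B) (t : ℕ → A) (k : ℤ) :
    φ (hval t k) = hval (fun m => φ (t m)) k := by
  have h : PowerSeries.map (φ : A →+* B) (xi t) = xi fun m => φ (t m) := by
    ext n
    cases n <;> simp [xi]
  rw [hval, hval, zcoeff, zcoeff]
  split_ifs
  · rw [expXi, expXi, ← h, ← map_expSeries φ (constantCoeff_xi t), PowerSeries.coeff_map]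
    rfl
  · exact map_zero φ

theorem p_eq_hval (k : ℤ) : p k = hval (fun m => (MvPolynomial.X m : MvPolynomial ℕ ℂ)) k := by
  cases k with
  | ofNat k => exact (zcoeff_natCast _ k).symm
  | negSucc k => exact (hval_of_neg _ (Int.negSucc_lt_zero k)).symm

theorem aeval_p (t : ℕ → A) (k : ℤ) : MvPolynomial.aeval t (p k) = hval t k := by
  rw [p_eq_hval, map_hval]
  simp

/-- The recursion obtained from `d/dz e^{ξ(t, z)} = (d/dz ξ(t, z)) e^{ξ(t, z)}`. -/
theorem succ_mul_hval (t : ℕ → A) (n : ℕ) :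
    ((n : A) + 1) * hval t (n + 1 : ℕ) =
      ∑ i ∈ Finset.range (n + 1), ((i : A) + 1) * t i * hval t ((n : ℤ) - i) := by
  have h := congrArg (PowerSeries.coeff n) (derivative_expSeries (constantCoeff_xi t))
  rw [PowerSeries.coeff_derivative, PowerSeries.coeff_mul,
    Finset.Nat.sum_antidiagonal_eq_sum_range_succ_mk] at h
  rw [hval, zcoeff_natCast, mul_comm, expXi, h]
  refine Finset.sum_congr rfl fun i hi => ?_
  rw [Finset.mem_range] at hi
  rw [PowerSeries.coeff_derivative, coeff_succ_xi, hval, ← Nat.cast_sub (by omega), zcoeff_natCast,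
    mul_comm (t i)]
  rfl

/-- The point `[z] = (z, z²/2, z³/3, …)`. -/
def bracket (z : A) (m : ℕ) : A := ((m + 1 : ℂ)⁻¹) • z ^ (m + 1)

/-- The series `ξ(-[z], X)` is `log (1 - zX)`; the proof compares logarithmic derivatives. -/
theorem expXi_neg_bracket (z : A) :
    expXi (-bracket z) = 1 - PowerSeries.C z * PowerSeries.X := by
  refine eq_of_derivative_eq_mul (g := PowerSeries.derivative A (xi (-bracket z))) ?_
    (derivative_expSeries (constantCoeff_xi _)) ?_
  · simp [expXi, constantCoeff_expSeries (constantCoeff_xi _)]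
  · have h : PowerSeries.derivative A (xi (-bracket z)) = PowerSeries.mk fun n => - z ^ (n + 1) := by
      ext n
      rw [PowerSeries.coeff_derivative, coeff_succ_xi, PowerSeries.coeff_mk, Pi.neg_apply, bracket,
        neg_mul, smul_mul_assoc, mul_comm, ← smul_mul_assoc]
      congr 1
      have h1 : ((n : A) + 1) = algebraMap ℂ A ((n : ℂ) + 1) := by simp
      rw [h1, Algebra.smul_def, ← map_mul, inv_mul_cancel₀ (Nat.cast_add_one_ne_zero n), map_one,
        one_mul]
    rw [h]
    ext n
    rw [mul_sub, mul_one, map_sub (PowerSeries.coeff n), ← mul_assoc, PowerSeries.coeff_mk]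
    cases n with
    | zero => simp
    | succ n =>
      rw [PowerSeries.coeff_succ_mul_X, PowerSeries.coeff_mul_C, PowerSeries.coeff_mk]
      simp
      ring

theorem hval_sub_bracket (t : ℕ → A) (z : A) (k : ℤ) :
    hval (t - bracket z) k = hval t k - z * hval t (k - 1) := by
  rw [hval, sub_eq_add_neg, add_comm, expXi_add, expXi_neg_bracket, zcoeff_one_sub_mul]
  rfl

/-- The shift by `+[z]` divides by `1 - zX`. Writing this as a two-term relation between
neighbouring indices, not as a geometric series, makes it usable in column operations. -/
theorem hval_add_bracket (t : ℕ → A) (z : A) (k : ℤ) :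
    hval t k = hval (t + bracket z) k - z * hval (t + bracket z) (k - 1) := by
  rw [← hval_sub_bracket, add_sub_cancel_right]

end Exponential

/-! ### Jacobi–Trudi determinants indexed by tuples of levels -/

section JacobiTrudi

variable {A : Type*} [CommRing A]

/-- The determinant `det (h (r_i - M + 1 + j))`, for a tuple `r` of `M` levels.  If `r` is strictly
decreasing, this is the Jacobi–Trudi determinant of the partition `(r_i - (M - 1 - i))_i`. -/
def jdet (h : ℤ → A) {M : ℕ} (r : Fin M → ℕ) : A :=
  Matrix.det (Matrix.of fun i j : Fin M => h ((r i : ℤ) - M + 1 + j))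

theorem map_jdet {B : Type*} [CommRing B] (φ : A →+* B) (h : ℤ → A) {M : ℕ} (r : Fin M → ℕ) :
    φ (jdet h r) = jdet (fun k => φ (h k)) r := by
  rw [jdet, RingHom.map_det]
  rfl

/-- The minor of the matrix of `jdet h (Fin.cons n t)` obtained by deleting row `0`, column `j`. -/
def topMinor (h : ℤ → A) {N : ℕ} (t : Fin N → ℕ) (j : Fin (N + 1)) : A :=
  Matrix.det (Matrix.of fun i k : Fin N => h ((t i : ℤ) - N + (j.succAbove k : ℕ)))

theorem jdet_cons (h : ℤ → A) {N : ℕ} (n : ℕ) (t : Fin N → ℕ) :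
    jdet h (Fin.cons n t : Fin (N + 1) → ℕ) =
      ∑ j : Fin (N + 1), (-1) ^ (j : ℕ) * h ((n : ℤ) - N + j) * topMinor h t j := by
  rw [jdet, Matrix.det_succ_row_zero]
  refine Finset.sum_congr rfl fun j _ => ?_
  congr 1
  · simp only [Matrix.of_apply, Fin.cons_zero]
    congr 2
    push_cast
    ring
  · rw [topMinor]
    congr 1
    ext i k
    simp only [Matrix.submatrix_apply, Matrix.of_apply, Fin.cons_succ]
    congr 1
    push_cast
    ring

/-- Border the matrix with the top row `1, z, z², …`. Subtracting `z` times the preceding column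
clears that row after its first entry and produces the left side; expanding along the same row
beforehand gives the right side. -/
theorem jdet_sub_mul_shift (h : ℤ → A) (z : A) {N : ℕ} (t : Fin (N + 1) → ℕ) :
    jdet (fun k => h k - z * h (k - 1)) t =
      ∑ j : Fin (N + 2), (-1) ^ (j : ℕ) * z ^ (j : ℕ) * topMinor h t j := by
  set P : Matrix (Fin (N + 2)) (Fin (N + 2)) A := Matrix.of fun i j =>
    (Fin.cons (z ^ (j : ℕ)) fun i => h ((t i : ℤ) - (N + 1 : ℕ) + j) : Fin (N + 2) → A) i with hP
  set Q : Matrix (Fin (N + 2)) (Fin (N + 2)) A := Matrix.of fun i j =>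
    (Fin.cons (P i 0) fun j => P i j.succ - z * P i j.castSucc : Fin (N + 2) → A) j with hQ
  have hPQ : P.det = Q.det := by
    refine Matrix.det_eq_of_forall_col_eq_smul_add_pred (fun _ => z) (fun i => ?_) fun i j => ?_
    · rw [hQ, Matrix.of_apply, Fin.cons_zero]
    · rw [hQ, Matrix.of_apply, Fin.cons_succ, sub_add_cancel]
  have h1 : Q.det = jdet (fun k => h k - z * h (k - 1)) t := by
    rw [Matrix.det_succ_row_zero, Fin.sum_univ_succ, Finset.sum_eq_zero, add_zero]
    · have h00 : Q 0 0 = 1 := by simp [hQ, hP]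
      rw [h00, jdet]
      simp only [Fin.val_zero, pow_zero, one_mul]
      congr 1
      ext i j
      simp only [hQ, hP, Matrix.submatrix_apply, Matrix.of_apply, Fin.succAbove_zero, Fin.cons_succ,
        Fin.val_succ, Fin.val_castSucc]
      rw [show ((t i : ℤ) - (N + 1 : ℕ) + 1 + (j : ℕ) - 1) = t i - (N + 1 : ℕ) + (j : ℕ) by ring]
      congr 2
      push_cast
      ring
    · intro j _
      have h0 : Q 0 j.succ = 0 := by simp [hQ, hP, pow_succ, mul_comm]
      rw [h0]
      ring
  rw [← h1, ← hPQ, Matrix.det_succ_row_zero]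
  refine Finset.sum_congr rfl fun j _ => ?_
  rfl

/-- Expansion along the first column of a matrix whose other columns are those of a Jacobi–Trudi
determinant. -/
theorem sum_mul_jdet_removeNth (h : ℤ → A) {N : ℕ} (t : Fin (N + 1) → ℕ) (g : Fin (N + 1) → A) :
    ∑ i : Fin (N + 1), (-1) ^ (i : ℕ) * g i * jdet h (i.removeNth t) =
      Matrix.det (Matrix.of fun i j : Fin (N + 1) =>
        (Fin.cons (g i) fun j => h ((t i : ℤ) - N + 1 + (j : ℕ)) : Fin (N + 1) → A) j) := by
  rw [Matrix.det_succ_column_zero]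
  rfl

/-- For `s` in this range the first column repeats one of the Jacobi–Trudi columns. -/
theorem sum_mul_jdet_removeNth_eq_zero (h : ℤ → A) {N : ℕ} (t : Fin (N + 1) → ℕ) {s : ℤ}
    (hs : 1 ≤ s) (hsN : s ≤ N) :
    ∑ i : Fin (N + 1), (-1) ^ (i : ℕ) * h ((t i : ℤ) - N + s) * jdet h (i.removeNth t) = 0 := by
  rw [sum_mul_jdet_removeNth h t fun i => h ((t i : ℤ) - N + s)]
  obtain ⟨c, rfl⟩ : ∃ c : ℕ, s = c + 1 := ⟨(s - 1).toNat, by omega⟩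
  refine Matrix.det_zero_of_column_eq (i := 0) (j := Fin.succ ⟨c, by omega⟩) (Fin.succ_ne_zero _).symm
    fun i => ?_
  simp only [Matrix.of_apply, Fin.cons_zero, Fin.cons_succ]
  congr 1
  ring

/-- Subtracting `z` times the preceding column turns every column of `h'` except the first into a
column of `h`, so the expansion along the first column involves `h'` only linearly. -/
theorem jdet_eq_sum_of_shift {h h' : ℤ → A} {z : A} (hh : ∀ k, h k = h' k - z * h' (k - 1)) {N : ℕ}
    (t : Fin (N + 1) → ℕ) :
    jdet h' t = ∑ i : Fin (N + 1), (-1) ^ (i : ℕ) * h' ((t i : ℤ) - N) * jdet h (i.removeNth t) := by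
  rw [sum_mul_jdet_removeNth h t fun i => h' ((t i : ℤ) - N), jdet]
  refine Matrix.det_eq_of_forall_col_eq_smul_add_pred (fun _ => z) (fun i => ?_) fun i j => ?_
  · simp only [Matrix.of_apply, Fin.cons_zero, Fin.val_zero]
    congr 1
    push_cast
    ring
  · simp only [Matrix.of_apply, Fin.cons_succ, hh, Fin.val_succ, Fin.val_castSucc]
    push_cast
    ring_nf

end JacobiTrudi

/-! ### The residue of a product of two Jacobi–Trudi determinants -/

section Residue

variable {R : Type*} [CommRing R] [Algebra ℂ R]

theorem hval_C (u : ℕ → R) (k : ℤ) :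
    hval (fun m => (PowerSeries.C (u m) : R⟦X⟧)) k = PowerSeries.C (hval u k) :=
  (map_hval (IsScalarTower.toAlgHom ℂ R R⟦X⟧) u k).symm

/-- This is `p_k(v + [z]) = ∑_b p_{k-b}(v) z^b`, obtained by iterating the two-term relation. -/
theorem coeff_hval_C_add_bracket (v : ℕ → R) (b : ℕ) (k : ℤ) :
    PowerSeries.coeff b (hval ((fun m => (PowerSeries.C (v m) : R⟦X⟧)) + bracket PowerSeries.X) k) =
      hval v (k - b) := by
  have h := fun k => hval_add_bracket (fun m => (PowerSeries.C (v m) : R⟦X⟧)) PowerSeries.X k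
  simp only [hval_C] at h
  have h' := fun k => eq_add_of_sub_eq (h k).symm
  induction b generalizing k with
  | zero => rw [h']; simp
  | succ b ih =>
    rw [h', map_add, PowerSeries.coeff_succ_X_mul, ih, PowerSeries.coeff_C]
    simp only [Nat.add_eq_zero_iff, one_ne_zero, and_false, if_false, zero_add]
    congr 1
    push_cast
    ring

/-- The power series `χ(u - [z])` in `z`, for a Jacobi–Trudi determinant `χ`. -/
def jdetMinus (u : ℕ → R) {M : ℕ} (t : Fin M → ℕ) : R⟦X⟧ :=
  jdet (hval ((fun m => (PowerSeries.C (u m) : R⟦X⟧)) - bracket PowerSeries.X)) t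

/-- The power series `χ(v + [z])` in `z`, for a Jacobi–Trudi determinant `χ`. -/
def jdetPlus (v : ℕ → R) {M : ℕ} (t : Fin M → ℕ) : R⟦X⟧ :=
  jdet (hval ((fun m => (PowerSeries.C (v m) : R⟦X⟧)) + bracket PowerSeries.X)) t

theorem jdetMinus_eq (u : ℕ → R) {N : ℕ} (t : Fin (N + 1) → ℕ) :
    jdetMinus u t = ∑ j : Fin (N + 2),
      PowerSeries.C ((-1) ^ (j : ℕ) * topMinor (hval u) t j) * PowerSeries.X ^ (j : ℕ) := by
  have h : hval ((fun m => (PowerSeries.C (u m) : R⟦X⟧)) - bracket PowerSeries.X) = fun k =>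
      PowerSeries.C (hval u k) - PowerSeries.X * PowerSeries.C (hval u (k - 1)) := by
    funext k
    rw [hval_sub_bracket, hval_C, hval_C]
  rw [jdetMinus, h, jdet_sub_mul_shift (fun k => PowerSeries.C (hval u k)) PowerSeries.X]
  refine Finset.sum_congr rfl fun j _ => ?_
  have hm : topMinor (fun k => (PowerSeries.C (hval u k) : R⟦X⟧)) t j =
      PowerSeries.C (topMinor (hval u) t j) := by
    rw [topMinor, topMinor, RingHom.map_det]
    rfl
  rw [hm, map_mul, map_pow, map_neg, map_one]
  ring

theorem jdetPlus_eq (v : ℕ → R) {N : ℕ} (t : Fin (N + 1) → ℕ) :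
    jdetPlus v t = ∑ i : Fin (N + 1), PowerSeries.C ((-1) ^ (i : ℕ) * jdet (hval v) (i.removeNth t)) *
      hval ((fun m => (PowerSeries.C (v m) : R⟦X⟧)) + bracket PowerSeries.X) ((t i : ℤ) - N) := by
  rw [jdetPlus, jdet_eq_sum_of_shift (h := fun k => PowerSeries.C (hval v k)) (z := PowerSeries.X)]
  · refine Finset.sum_congr rfl fun i _ => ?_
    rw [← map_jdet, map_mul, map_pow, map_neg, map_one]
    ring
  · intro k
    rw [← hval_C, hval_add_bracket]

theorem coeff_succ_jdetMinus_mul_jdetPlus (u v : ℕ → R) {N : ℕ} (t t' : Fin (N + 1) → ℕ) (a : ℕ) :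
    PowerSeries.coeff (a + 1) (jdetMinus u t * jdetPlus v t') =
      ∑ i : Fin (N + 1), ∑ j : Fin (N + 2),
        ((-1) ^ (i : ℕ) * jdet (hval v) (i.removeNth t')) *
        ((-1) ^ (j : ℕ) * topMinor (hval u) t j) * hval v ((t' i : ℤ) - (N + 1 : ℕ) + j - a) := by
  rw [jdetMinus_eq, jdetPlus_eq, Finset.sum_mul_sum, map_sum]
  simp only [map_sum]
  conv_rhs => rw [Finset.sum_comm]
  refine Finset.sum_congr rfl fun j _ => ?_
  have hterm : ∀ i : Fin (N + 1), PowerSeries.coeff (a + 1)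
      (PowerSeries.C ((-1) ^ (j : ℕ) * topMinor (hval u) t j) * PowerSeries.X ^ (j : ℕ) *
      (PowerSeries.C ((-1) ^ (i : ℕ) * jdet (hval v) (i.removeNth t')) *
        hval ((fun m => (PowerSeries.C (v m) : R⟦X⟧)) + bracket PowerSeries.X) ((t' i : ℤ) - N))) =
      if (j : ℕ) ≤ a + 1 then ((-1) ^ (i : ℕ) * jdet (hval v) (i.removeNth t')) *
        ((-1) ^ (j : ℕ) * topMinor (hval u) t j) * hval v ((t' i : ℤ) - (N + 1 : ℕ) + j - a)
      else 0 := by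
    intro i
    rw [show ∀ c d x y : R⟦X⟧, c * x * (d * y) = c * (d * (x * y)) by intros; ring,
      PowerSeries.coeff_C_mul, PowerSeries.coeff_C_mul, PowerSeries.coeff_X_pow_mul']
    split_ifs with hj
    · rw [coeff_hval_C_add_bracket, Nat.cast_sub hj]
      rw [show (t' i : ℤ) - N - ((a + 1 : ℕ) - (j : ℕ)) = t' i - (N + 1 : ℕ) + j - a by
        push_cast; ring]
      ring
    · ring
  rw [Finset.sum_congr rfl fun i _ => hterm i]
  by_cases hj : (j : ℕ) ≤ a + 1
  · simp only [hj, if_true]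
  · simp only [hj, if_false, Finset.sum_const_zero]
    -- For `j > a + 1` the power `z^j` is too high to contribute. The terms in the claimed formula
    -- need not vanish one by one, but their sum over `i` is a determinant with a repeated column.
    -- Hence `j` may range freely.
    have h0 := sum_mul_jdet_removeNth_eq_zero (hval v) t' (s := (j : ℤ) - 1 - a) (by omega)
      (by have := j.2; omega)
    rw [← mul_zero ((-1) ^ (j : ℕ) * topMinor (hval u) t j), ← h0, Finset.mul_sum]
    refine Finset.sum_congr rfl fun i _ => ?_
    rw [show (t' i : ℤ) - N + (j - 1 - a) = t' i - (N + 1 : ℕ) + j - a by push_cast; ring]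
    ring

/-- The coefficient of `k⁻¹` in `e^{ξ(u - v, k)} χ(u - [k⁻¹]) χ'(v + [k⁻¹])` for two Jacobi–Trudi
determinants `χ` and `χ'`. -/
theorem hasSum_residue [TopologicalSpace R] (u v : ℕ → R) {N : ℕ} (t t' : Fin (N + 1) → ℕ) :
    HasSum (fun a : ℕ => PowerSeries.coeff a (expXi (u - v)) *
        PowerSeries.coeff (a + 1) (jdetMinus u t * jdetPlus v t'))
      (∑ i : Fin (N + 1), (-1) ^ (i : ℕ) * jdet (hval u) (Fin.cons (t' i) t : Fin (N + 2) → ℕ) *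
        jdet (hval v) (i.removeNth t')) := by
  -- For `a ≥ B` every index of `hval v` in the coefficient formula is negative, so the sum over `a`
  -- is finite.
  set B : ℕ := ∑ i, t' i + 1 with hB
  have hlt : ∀ (i : Fin (N + 1)) (j : Fin (N + 2)), (t' i : ℤ) - (N + 1 : ℕ) + j < B := by
    intro i j
    have h1 : t' i ≤ ∑ i, t' i := Finset.single_le_sum (fun _ _ => Nat.zero_le _) (Finset.mem_univ i)
    have h2 := j.2
    push_cast
    omega
  have hsum : ∑ i : Fin (N + 1), (-1) ^ (i : ℕ) * jdet (hval u) (Fin.cons (t' i) t : Fin (N + 2) → ℕ) *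
        jdet (hval v) (i.removeNth t') = ∑ a ∈ Finset.range B, PowerSeries.coeff a (expXi (u - v)) *
        PowerSeries.coeff (a + 1) (jdetMinus u t * jdetPlus v t') := by
    simp only [coeff_succ_jdetMinus_mul_jdetPlus, Finset.mul_sum]
    rw [Finset.sum_comm]
    refine Finset.sum_congr rfl fun i _ => ?_
    rw [Finset.sum_comm, jdet_cons, Finset.mul_sum, Finset.sum_mul]
    refine Finset.sum_congr rfl fun j _ => ?_
    -- Since `e^{ξ(u)} = e^{ξ(u - v)} e^{ξ(v)}`, the sum over `a` turns the entries in `v` into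
    -- entries in `u`. These are the entries of the row of level `t' i`, now placed on top of the
    -- rows of `t`.
    have h : hval u ((t' i : ℤ) - (N + 1 : ℕ) + j) = ∑ a ∈ Finset.range B,
        PowerSeries.coeff a (expXi (u - v)) * hval v ((t' i : ℤ) - (N + 1 : ℕ) + j - a) := by
      conv_lhs => rw [← sub_add_cancel u v]
      rw [hval, expXi_add, zcoeff_mul_eq_sum_range _ _ _ (hlt i j)]
      rfl
    rw [h]
    simp only [Finset.mul_sum, Finset.sum_mul]
    refine Finset.sum_congr rfl fun a _ => ?_
    ring
  rw [hsum]
  refine hasSum_sum_of_ne_finset_zero fun a ha => ?_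
  have hBa : B ≤ a := by simpa using ha
  rw [coeff_succ_jdetMinus_mul_jdetPlus]
  refine mul_eq_zero_of_right _ (Finset.sum_eq_zero fun i _ => Finset.sum_eq_zero fun j _ => ?_)
  have := hlt i j
  rw [hval_of_neg _ (by omega), mul_zero]

end Residue

/-! ### Young diagrams and strictly decreasing tuples -/

section Levels

theorem add_le_of_strictAnti {M : ℕ} {t : Fin M → ℕ} (ht : StrictAnti t) {i j : Fin M}
    (hij : i ≤ j) : t j + (j - i : ℕ) ≤ t i := by
  obtain ⟨d, hd⟩ : ∃ d : ℕ, (j : ℕ) = i + d := ⟨j - i, by have := Fin.le_def.1 hij; omega⟩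
  induction d generalizing j with
  | zero =>
    have : j = i := Fin.ext (by omega)
    simp [this]
  | succ d ih =>
    have hlt : (i : ℕ) + d < M := by have := j.2; omega
    have h1 := @ih ⟨i + d, hlt⟩ (Fin.le_def.2 (by simp)) rfl
    have h2 : t j < t ⟨i + d, hlt⟩ := ht (Fin.lt_def.2 (by simp; omega))
    simp only at h1
    omega

/-- The levels `λ_i + (M - 1 - i)` of the first `M` rows of a Young diagram. -/
def lev (lam : YoungDiagram) (M : ℕ) (i : Fin M) : ℕ := lam.rowLen i + (M - 1 - i)

theorem strictAnti_lev (lam : YoungDiagram) (M : ℕ) : StrictAnti (lev lam M) := by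
  intro i j hij
  have h := lam.rowLen_anti i j (Fin.le_def.1 hij.le)
  have h1 := Fin.lt_def.1 hij
  have h2 := j.2
  simp only [lev]
  omega

/-- The Young diagram whose `i`-th row has `t_i - (M - 1 - i)` cells. -/
def diag {M : ℕ} (t : Fin M → ℕ) : YoungDiagram where
  -- The bound `∑ i, t i` only ensures finiteness. Imposing the inequality on all rows above the
  -- cell as well makes this a lower set even when `t` is not decreasing.
  cells := (Finset.range M ×ˢ Finset.range (∑ i, t i)).filter
    fun c => ∀ i : Fin M, (i : ℕ) ≤ c.1 → c.2 + (M - 1 - i) < t i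
  isLowerSet := by
    rintro ⟨a, b⟩ ⟨a', b'⟩ hle hmem
    obtain ⟨h1, h2⟩ : a' ≤ a ∧ b' ≤ b := hle
    simp only [Finset.coe_filter, Finset.mem_product, Finset.mem_range, Set.mem_ofPred_eq] at hmem ⊢
    obtain ⟨⟨h3, h4⟩, h5⟩ := hmem
    refine ⟨⟨by omega, by omega⟩, fun i hi => ?_⟩
    have := h5 i (by omega)
    omega

theorem mem_diag {M : ℕ} {t : Fin M → ℕ} (ht : StrictAnti t) {a b : ℕ} :
    (a, b) ∈ diag t ↔ ∃ h : a < M, b + (M - 1 - a) < t ⟨a, h⟩ := by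
  rw [← YoungDiagram.mem_cells]
  simp only [diag, Finset.mem_filter, Finset.mem_product, Finset.mem_range]
  constructor
  · rintro ⟨⟨h1, h2⟩, h3⟩
    exact ⟨h1, h3 ⟨a, h1⟩ le_rfl⟩
  · rintro ⟨h1, h2⟩
    have h3 : t ⟨a, h1⟩ ≤ ∑ i, t i := Finset.single_le_sum (fun _ _ => Nat.zero_le _)
      (Finset.mem_univ _)
    refine ⟨⟨h1, by omega⟩, fun i hi => ?_⟩
    have := add_le_of_strictAnti ht (show i ≤ ⟨a, h1⟩ from hi)
    simp only at this
    omega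

theorem rowLen_diag {M : ℕ} {t : Fin M → ℕ} (ht : StrictAnti t) (i : Fin M) :
    (diag t).rowLen i = t i - (M - 1 - i) := by
  refine eq_of_forall_lt_iff fun b => ?_
  rw [← YoungDiagram.mem_iff_lt_rowLen, mem_diag ht]
  simp only [Fin.is_lt, Fin.eta, exists_true_left]
  omega

theorem lev_diag {M : ℕ} {t : Fin M → ℕ} (ht : StrictAnti t) : lev (diag t) M = t := by
  funext i
  rw [lev, rowLen_diag ht]
  have h := i.2
  have := add_le_of_strictAnti ht (show i ≤ ⟨M - 1, by omega⟩ from Fin.le_def.2 (by simp; omega))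
  simp only at this
  omega

theorem colLen_le_iff (lam : YoungDiagram) (M : ℕ) : lam.colLen 0 ≤ M ↔ lam.rowLen M = 0 := by
  rw [← not_lt, ← YoungDiagram.mem_iff_lt_colLen, YoungDiagram.mem_iff_lt_rowLen]
  omega

theorem colLen_diag_le {M : ℕ} {t : Fin M → ℕ} (ht : StrictAnti t) : (diag t).colLen 0 ≤ M := by
  rw [← not_lt, ← YoungDiagram.mem_iff_lt_colLen, mem_diag ht]
  rintro ⟨h, -⟩
  exact lt_irrefl _ h

theorem rowLen_eq_zero {lam : YoungDiagram} {M : ℕ} (h : lam.colLen 0 ≤ M) {i : ℕ} (hi : M ≤ i) :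
    lam.rowLen i = 0 := (colLen_le_iff _ _).1 (h.trans hi)

theorem ext_rowLen {lam mu : YoungDiagram} (h : ∀ i, lam.rowLen i = mu.rowLen i) : lam = mu := by
  ext ⟨a, b⟩
  rw [YoungDiagram.mem_cells, YoungDiagram.mem_cells, YoungDiagram.mem_iff_lt_rowLen,
    YoungDiagram.mem_iff_lt_rowLen, h]

theorem diag_lev {lam : YoungDiagram} {M : ℕ} (h : lam.colLen 0 ≤ M) : diag (lev lam M) = lam := by
  refine ext_rowLen fun i => ?_
  rcases lt_or_ge i M with hi | hi
  · have := rowLen_diag (strictAnti_lev lam M) ⟨i, hi⟩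
    simp only [lev] at this
    omega
  · rw [rowLen_eq_zero h hi, rowLen_eq_zero (colLen_diag_le (strictAnti_lev lam M)) hi]

theorem card_eq_sum_rowLen {lam : YoungDiagram} {M : ℕ} (h : lam.colLen 0 ≤ M) :
    lam.card = ∑ i : Fin M, lam.rowLen i := by
  rw [YoungDiagram.card, Finset.card_eq_sum_card_fiberwise (f := Prod.fst) (t := Finset.range M),
    Finset.sum_range]
  · refine Finset.sum_congr rfl fun i _ => ?_
    rw [YoungDiagram.rowLen_eq_card]
    rfl
  · rintro ⟨a, b⟩ hab
    have h1 : (a, 0) ∈ lam := lam.up_left_mem le_rfl (Nat.zero_le b) hab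
    rw [YoungDiagram.mem_iff_lt_colLen] at h1
    simp only [Finset.coe_range, Set.mem_Iio]
    omega

theorem sum_lev {lam : YoungDiagram} {M : ℕ} (h : lam.colLen 0 ≤ M) :
    ∑ i, lev lam M i = lam.card + ∑ i : Fin M, (M - 1 - i : ℕ) := by
  rw [card_eq_sum_rowLen h, ← Finset.sum_add_distrib]
  rfl

theorem colLen_le_card (lam : YoungDiagram) : lam.colLen 0 ≤ lam.card := by
  rw [YoungDiagram.colLen_eq_card]
  exact Finset.card_le_card (Finset.filter_subset _ _)

theorem rowLen_le_card (lam : YoungDiagram) (i : ℕ) : lam.rowLen i ≤ lam.card := by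
  rw [YoungDiagram.rowLen_eq_card]
  exact Finset.card_le_card (Finset.filter_subset _ _)

theorem p_zero : p 0 = 1 := by rw [p_eq_hval, hval_zero]

theorem p_of_neg {k : ℤ} (hk : k < 0) : p k = 0 := by rw [p_eq_hval, hval_of_neg _ hk]

/-- An additional empty row adds a last matrix row `(0, …, 0, 1)`, since `p_k = 0` for `k < 0`. Thus
all partitions of bounded length can use determinants of one common size. -/
theorem schur_eq_det {lam : YoungDiagram} {M : ℕ} (h : lam.colLen 0 ≤ M) :
    schur lam = Matrix.det (Matrix.of fun i j : Fin M => p ((lam.rowLen i : ℤ) - i + j)) := by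
  induction M, h using Nat.le_induction with
  | base => rfl
  | succ M hM ih =>
    rw [ih, Matrix.det_succ_row _ (Fin.last M), Fin.sum_univ_castSucc, Finset.sum_eq_zero, zero_add]
    · simp [rowLen_eq_zero hM le_rfl, p_zero, ← two_mul]
      rfl
    · intro j _
      have h0 : p ((lam.rowLen (Fin.last M : ℕ) : ℤ) - (Fin.last M : ℕ) + (j.castSucc : ℕ)) = 0 := by
        refine p_of_neg ?_
        have := j.2
        rw [Fin.val_last, rowLen_eq_zero hM le_rfl, Fin.val_castSucc]
        omega
      rw [Matrix.of_apply, h0]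
      ring

theorem schur_eq_jdet {lam : YoungDiagram} {M : ℕ} (h : lam.colLen 0 ≤ M) :
    schur lam = jdet p (lev lam M) := by
  rw [schur_eq_det h, jdet]
  congr 1
  ext i j : 2
  have := i.2
  rw [Matrix.of_apply, Matrix.of_apply, lev,
    show ((lam.rowLen i + (M - 1 - i) : ℕ) : ℤ) - M + 1 + (j : ℕ) = lam.rowLen i - (i : ℕ) + (j : ℕ)
      by omega]

theorem schur_diag {M : ℕ} {t : Fin M → ℕ} (ht : StrictAnti t) : schur (diag t) = jdet p t := by
  rw [schur_eq_jdet (colLen_diag_le ht), lev_diag ht]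

end Levels

/-! ### The Schur functions form a homogeneous basis -/

section Basis

/-- The weight of `x_{m+1}`. -/
def wt (m : ℕ) : ℕ := m + 1

theorem finite_card_eq (w : ℕ) : {lam : YoungDiagram | lam.card = w}.Finite := by
  refine Set.Finite.of_finite_image (f := YoungDiagram.cells)
    (((Finset.range w ×ˢ Finset.range w).powerset.finite_toSet).subset ?_) ?_
  · rintro _ ⟨lam, hlam, rfl⟩
    have hlam : lam.card = w := hlam
    simp only [Finset.coe_powerset, Set.mem_preimage, Set.mem_powerset_iff, Finset.coe_subset]
    rintro ⟨a, b⟩ hab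
    rw [YoungDiagram.mem_cells] at hab
    have h1 := YoungDiagram.mem_iff_lt_rowLen.1 hab
    have h2 := YoungDiagram.mem_iff_lt_colLen.1 (lam.up_left_mem le_rfl (Nat.zero_le b) hab)
    have h3 := colLen_le_card lam
    have h4 := rowLen_le_card lam a
    simp only [Finset.mem_product, Finset.mem_range]
    omega
  · intro lam _ mu _ h
    exact YoungDiagram.ext h

/-- The partitions of `w`. -/
def diagrams (w : ℕ) : Finset YoungDiagram := (finite_card_eq w).toFinset

theorem mem_diagrams {w : ℕ} {lam : YoungDiagram} : lam ∈ diagrams w ↔ lam.card = w := by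
  simp [diagrams]

theorem p_natCast_succ (n : ℕ) : p (n + 1 : ℕ) = ((n : ℂ) + 1)⁻¹ •
    ∑ i ∈ Finset.range (n + 1), ((i : ℂ) + 1) • (MvPolynomial.X i * p ((n : ℤ) - i)) := by
  have h := succ_mul_hval (fun m => (MvPolynomial.X m : MvPolynomial ℕ ℂ)) n
  simp only [← p_eq_hval] at h
  rw [eq_inv_smul_iff₀ (Nat.cast_add_one_ne_zero n), Algebra.smul_def]
  simp only [map_add, map_natCast, map_one]
  rw [h]
  refine Finset.sum_congr rfl fun i _ => ?_
  rw [Algebra.smul_def, mul_assoc]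
  simp

theorem isWeightedHomogeneous_p (n : ℕ) : (p n).IsWeightedHomogeneous wt n := by
  induction n using Nat.strong_induction_on with
  | _ n ih =>
    cases n with
    | zero =>
      rw [Nat.cast_zero, p_zero]
      exact MvPolynomial.isWeightedHomogeneous_one _ _
    | succ n =>
      rw [p_natCast_succ]
      refine Submodule.smul_mem (MvPolynomial.weightedHomogeneousSubmodule ℂ wt (n + 1)) _
        (Submodule.sum_mem _ fun i hi => Submodule.smul_mem _ _ ?_)
      rw [Finset.mem_range] at hi
      rw [← Nat.cast_sub (by omega), show n + 1 = wt i + (n - i) by simp only [wt]; omega]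
      exact (MvPolynomial.isWeightedHomogeneous_X _ _ _).mul (ih _ (by omega))

/-- In each term of the determinant the indices add up to `w`, unless some index is negative, in
which case the term is zero. -/
theorem isWeightedHomogeneous_jdet {M : ℕ} (r : Fin M → ℕ) {w : ℕ}
    (hw : ∑ i, r i = w + ∑ i : Fin M, (M - 1 - i : ℕ)) :
    (jdet p r).IsWeightedHomogeneous wt w := by
  rw [jdet, Matrix.det_apply]
  refine Submodule.sum_mem (MvPolynomial.weightedHomogeneousSubmodule ℂ wt w) fun σ _ => ?_
  rw [Units.smul_def, zsmul_eq_mul, ← map_intCast (algebraMap ℂ (MvPolynomial ℕ ℂ)),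
    ← Algebra.smul_def]
  refine Submodule.smul_mem _ _ ?_
  simp only [Matrix.of_apply]
  by_cases hneg : ∃ i, (r (σ i) : ℤ) - M + 1 + (i : ℕ) < 0
  · obtain ⟨i, hi⟩ := hneg
    rw [Finset.prod_eq_zero (Finset.mem_univ i) (p_of_neg hi)]
    exact Submodule.zero_mem _
  · push Not at hneg
    have h : ∀ i, (r (σ i) : ℤ) - M + 1 + (i : ℕ) =
        (((r (σ i) : ℤ) - M + 1 + (i : ℕ)).toNat : ℕ) := fun i => (Int.toNat_of_nonneg (hneg i)).symm
    have hsum : ∑ i : Fin M, ((r (σ i) : ℤ) - M + 1 + (i : ℕ)).toNat = w := by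
      zify at hw ⊢
      simp only [Int.toNat_of_nonneg (hneg _)]
      have h1 : ∑ i : Fin M, ((M - 1 - i : ℕ) : ℤ) = ∑ i : Fin M, ((M : ℤ) - 1 - (i : ℕ)) :=
        Finset.sum_congr rfl fun i _ => by have := i.2; omega
      rw [h1] at hw
      have h2 : ∑ i, (r (σ i) : ℤ) = ∑ i, (r i : ℤ) := Equiv.sum_comp σ fun i => (r i : ℤ)
      have h3 : ∑ i : Fin M, ((r (σ i) : ℤ) - M + 1 + (i : ℕ)) =
          ∑ i, (r (σ i) : ℤ) - ∑ i : Fin M, ((M : ℤ) - 1 - (i : ℕ)) := by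
        rw [← Finset.sum_sub_distrib]
        exact Finset.sum_congr rfl fun i _ => by ring
      rw [h3, h2, hw]
      ring
    rw [← hsum]
    refine MvPolynomial.IsWeightedHomogeneous.prod _ _ _ fun i _ => ?_
    rw [h i]
    exact isWeightedHomogeneous_p _

theorem isWeightedHomogeneous_schur (lam : YoungDiagram) :
    (schur lam).IsWeightedHomogeneous wt lam.card := by
  rw [schur_eq_jdet le_rfl]
  exact isWeightedHomogeneous_jdet _ (sum_lev le_rfl)

/-- The span of the Schur functions of weight `w`. -/
def schurSpan (w : ℕ) : Submodule ℂ (MvPolynomial ℕ ℂ) :=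
  Submodule.span ℂ (schur '' {lam | lam.card = w})

theorem sum_mul_perm_le {M : ℕ} {b : Fin M → ℕ} (hb : Antitone b) (σ : Equiv.Perm (Fin M)) :
    ∑ i, (b i : ℤ) * (i : ℕ) ≤ ∑ i, (b (σ i) : ℤ) * (i : ℕ) := by
  refine Antivary.sum_mul_le_sum_comp_perm_mul (f := fun i => (b i : ℤ))
    (g := fun i : Fin M => ((i : ℕ) : ℤ)) fun i j hij => ?_
  have h : ((i : ℕ) : ℤ) < (j : ℕ) := hij
  exact Nat.cast_le.2 (hb (Fin.le_def.2 (by omega)))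

/-- Expanding the square leaves a cross term, nonnegative by the rearrangement inequality, and `∑ (i
- σ i)²`, positive for `σ ≠ 1`. This makes the Jacobi–Trudi determinants unitriangular with respect
to the sum of squares. -/
theorem sum_sq_lt {M : ℕ} {b : Fin M → ℕ} (hb : Antitone b) {σ : Equiv.Perm (Fin M)} (hσ : σ ≠ 1) :
    ∑ i, (b i : ℤ) ^ 2 < ∑ i, ((b (σ i) : ℤ) - (σ i : ℕ) + (i : ℕ)) ^ 2 := by
  have h1 := sum_mul_perm_le hb σ
  have h2 : ∑ i, (b (σ i) : ℤ) ^ 2 = ∑ i, (b i : ℤ) ^ 2 := Equiv.sum_comp σ fun i => (b i : ℤ) ^ 2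
  have h3 : ∑ i, (b (σ i) : ℤ) * (σ i : ℕ) = ∑ i, (b i : ℤ) * (i : ℕ) :=
    Equiv.sum_comp σ fun i => (b i : ℤ) * (i : ℕ)
  have h4 : 0 < ∑ i : Fin M, (((i : ℕ) : ℤ) - (σ i : ℕ)) ^ 2 := by
    obtain ⟨i, hi⟩ : ∃ i, σ i ≠ i := by
      by_contra h
      push Not at h
      exact hσ (Equiv.ext h)
    refine Finset.sum_pos' (fun _ _ => sq_nonneg _) ⟨i, Finset.mem_univ i, ?_⟩
    have h : ((i : ℕ) : ℤ) - (σ i : ℕ) ≠ 0 := fun h => hi (Fin.ext (by omega))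
    positivity
  have h5 : ∑ i, ((b (σ i) : ℤ) - (σ i : ℕ) + (i : ℕ)) ^ 2 = ∑ i, (b (σ i) : ℤ) ^ 2 +
      2 * (∑ i, (b (σ i) : ℤ) * (i : ℕ) - ∑ i, (b (σ i) : ℤ) * (σ i : ℕ)) +
      ∑ i : Fin M, (((i : ℕ) : ℤ) - (σ i : ℕ)) ^ 2 := by
    rw [← Finset.sum_sub_distrib, Finset.mul_sum, ← Finset.sum_add_distrib, ← Finset.sum_add_distrib]
    exact Finset.sum_congr rfl fun i _ => by ring
  rw [h5, h2, h3]
  linarith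

/-- After sorting, the product is the diagonal term of a Schur function. Every other nonzero term is
a product of the same weight with a larger sum of squares, which is bounded by the square of the
sum, so induction applies. -/
theorem prod_p_mem_schurSpan {M : ℕ} (a : Fin M → ℕ) : ∏ i, p (a i) ∈ schurSpan (∑ i, a i) := by
  obtain ⟨n, hn⟩ : ∃ n : ℕ, (∑ i, a i) ^ 2 - ∑ i, a i ^ 2 ≤ n := ⟨_, le_rfl⟩
  induction n using Nat.strong_induction_on generalizing a with
  | _ n ih =>
    set s : Equiv.Perm (Fin M) := Fin.revPerm.trans (Tuple.sort a) with hs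
    set b : Fin M → ℕ := a ∘ s with hb
    have hanti : Antitone b := fun i j hij => Tuple.monotone_sort a (Fin.rev_le_rev.2 hij)
    have hsum : ∑ i, b i = ∑ i, a i := Equiv.sum_comp s a
    have hsq : ∑ i, b i ^ 2 = ∑ i, a i ^ 2 := Equiv.sum_comp s fun i => a i ^ 2
    have hprod : ∏ i, p (b i) = ∏ i, p (a i) := Equiv.prod_comp s fun i => p (a i)
    rw [← hprod, ← hsum]
    set t : Fin M → ℕ := fun i => b i + (M - 1 - i) with ht
    have htanti : StrictAnti t := by
      intro i j hij
      have h := hanti hij.le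
      have h1 := Fin.lt_def.1 hij
      have h2 := j.2
      simp only [ht]
      omega
    have hcard : (diag t).card = ∑ i, b i := by
      have h := sum_lev (colLen_diag_le htanti)
      rw [lev_diag htanti, Finset.sum_add_distrib] at h
      omega
    have hmem : jdet p t ∈ schurSpan (∑ i, b i) := by
      rw [← schur_diag htanti]
      exact Submodule.subset_span ⟨_, hcard, rfl⟩
    have hterm : ∀ σ : Equiv.Perm (Fin M), ∏ i, (Matrix.of fun i j : Fin M =>
        p ((t i : ℤ) - M + 1 + (j : ℕ))) (σ i) i = ∏ i, p ((b (σ i) : ℤ) - (σ i : ℕ) + (i : ℕ)) := by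
      intro σ
      refine Finset.prod_congr rfl fun i _ => ?_
      have := (σ i).2
      rw [Matrix.of_apply]
      congr 1
      simp only [ht]
      omega
    rw [jdet, Matrix.det_apply, ← Finset.add_sum_erase _ _ (Finset.mem_univ (1 : Equiv.Perm (Fin M)))] at hmem
    simp only [hterm] at hmem
    simp only [Equiv.Perm.sign_one, one_smul, Equiv.Perm.one_apply, sub_add_cancel] at hmem
    refine (Submodule.add_mem_iff_left _ (Submodule.sum_mem _ fun σ hσ => ?_)).1 hmem
    rw [Units.smul_def]
    refine zsmul_mem ?_ _
    by_cases hneg : ∃ i, (b (σ i) : ℤ) - (σ i : ℕ) + (i : ℕ) < 0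
    · obtain ⟨i, hi⟩ := hneg
      rw [Finset.prod_eq_zero (Finset.mem_univ i) (p_of_neg hi)]
      exact Submodule.zero_mem _
    · push Not at hneg
      have hlt := sum_sq_lt hanti (Finset.ne_of_mem_erase hσ)
      choose e he using fun i => Int.eq_ofNat_of_zero_le (hneg i)
      simp only [he] at hlt ⊢
      have hesum : ∑ i, e i = ∑ i, b i := by
        zify
        simp only [← he]
        rw [Finset.sum_add_distrib, Finset.sum_sub_distrib, Equiv.sum_comp σ fun i => (b i : ℤ),
          Equiv.sum_comp σ fun i : Fin M => ((i : ℕ) : ℤ)]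
        ring
      have hlt' : ∑ i, b i ^ 2 < ∑ i, e i ^ 2 := by exact_mod_cast hlt
      -- This bound keeps the truncated subtraction exact, so the induction measure really drops.
      have hle : ∑ i, e i ^ 2 ≤ (∑ i, e i) ^ 2 := by
        rw [sq (∑ i, e i), Finset.sum_mul]
        refine Finset.sum_le_sum fun i _ => ?_
        rw [sq]
        exact Nat.mul_le_mul_left _
          (Finset.single_le_sum (fun _ _ => Nat.zero_le _) (Finset.mem_univ i))
      rw [← hesum]
      refine ih ((∑ i, e i) ^ 2 - ∑ i, e i ^ 2) ?_ e le_rfl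
      rw [hesum, hsum] at hle ⊢
      omega

end Basis

/-! ### Schur functions of weight `w` span, and are linearly independent -/

section Spanning

/-- The span of the products of `p_k`s of weight `w`. -/
def prodSpan (w : ℕ) : Submodule ℂ (MvPolynomial ℕ ℂ) :=
  Submodule.span ℂ ((fun s : Multiset ℕ => (s.map fun k : ℕ => p k).prod) '' {s | s.sum = w})

theorem prodSpan_le_schurSpan (w : ℕ) : prodSpan w ≤ schurSpan w := by
  refine Submodule.span_le.2 ?_
  rintro _ ⟨s, hs, rfl⟩
  induction s using Quotient.inductionOn with
  | _ l =>
    obtain ⟨n, a, rfl⟩ : ∃ (n : ℕ) (a : Fin n → ℕ), l = List.ofFn a :=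
      ⟨_, l.get, (List.ofFn_get l).symm⟩
    have h := prod_p_mem_schurSpan a
    rw [← List.sum_ofFn, ← List.prod_ofFn] at h
    have hs' : (List.ofFn a).sum = w := by simpa using hs
    rw [hs'] at h
    simpa [List.map_ofFn, Function.comp_def] using h

theorem one_mem_prodSpan : (1 : MvPolynomial ℕ ℂ) ∈ prodSpan 0 :=
  Submodule.subset_span ⟨0, by simp, by simp⟩

theorem p_mem_prodSpan (n : ℕ) : p n ∈ prodSpan n :=
  Submodule.subset_span ⟨{n}, by simp, by simp⟩

theorem mul_mem_prodSpan {i j : ℕ} {f g : MvPolynomial ℕ ℂ} (hf : f ∈ prodSpan i)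
    (hg : g ∈ prodSpan j) : f * g ∈ prodSpan (i + j) := by
  have h := Submodule.mul_mem_mul hf hg
  rw [prodSpan, prodSpan, Submodule.span_mul_span] at h
  refine Submodule.span_mono ?_ h
  rintro _ ⟨_, ⟨s, hs, rfl⟩, _, ⟨s', hs', rfl⟩, rfl⟩
  have hs : s.sum = i := hs
  have hs' : s'.sum = j := hs'
  exact ⟨s + s', by simp [hs, hs'], by simp⟩

/-- The recursion for `p_{m+1}` contains `x_{m+1}` with a nonzero coefficient; all its other terms
involve only earlier variables. -/
theorem X_mem_prodSpan (m : ℕ) : (MvPolynomial.X m : MvPolynomial ℕ ℂ) ∈ prodSpan (m + 1) := by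
  induction m using Nat.strong_induction_on with
  | _ m ih =>
    have h := p_natCast_succ m
    rw [eq_inv_smul_iff₀ (Nat.cast_add_one_ne_zero m), Finset.sum_range_succ, sub_self, p_zero,
      mul_one] at h
    have hX : (MvPolynomial.X m : MvPolynomial ℕ ℂ) = ((m : ℂ) + 1)⁻¹ • (((m : ℂ) + 1) •
        p (m + 1 : ℕ) -
        ∑ i ∈ Finset.range m, ((i : ℂ) + 1) • (MvPolynomial.X i * p ((m : ℤ) - i))) := by
      rw [eq_inv_smul_iff₀ (Nat.cast_add_one_ne_zero m), h, add_sub_cancel_left]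
    rw [hX]
    refine Submodule.smul_mem _ _ (Submodule.sub_mem _ (Submodule.smul_mem _ _ (p_mem_prodSpan _))
      (Submodule.sum_mem _ fun i hi => Submodule.smul_mem _ _ ?_))
    rw [Finset.mem_range] at hi
    rw [← Nat.cast_sub hi.le, show m + 1 = i + 1 + (m - i) by omega]
    exact mul_mem_prodSpan (ih i hi) (p_mem_prodSpan _)

theorem monomial_mem_prodSpan (d : ℕ →₀ ℕ) :
    MvPolynomial.monomial d (1 : ℂ) ∈ prodSpan (Finsupp.weight wt d) := by
  induction d using Finsupp.induction_linear with
  | zero => simpa using one_mem_prodSpan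
  | add d e hd he =>
    rw [map_add, ← mul_one (1 : ℂ), ← MvPolynomial.monomial_mul]
    exact mul_mem_prodSpan hd he
  | single i n =>
    rw [Finsupp.weight_single, ← MvPolynomial.X_pow_eq_monomial]
    induction n with
    | zero => simpa using one_mem_prodSpan
    | succ n ih =>
      rw [pow_succ, succ_nsmul]
      exact mul_mem_prodSpan ih (X_mem_prodSpan i)

theorem mem_schurSpan_of_isWeightedHomogeneous {f : MvPolynomial ℕ ℂ} {w : ℕ}
    (hf : f.IsWeightedHomogeneous wt w) : f ∈ schurSpan w := by
  rw [f.as_sum]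
  refine Submodule.sum_mem _ fun d hd => ?_
  rw [← mul_one (MvPolynomial.coeff d f), ← smul_eq_mul, ← MvPolynomial.smul_monomial,
    ← hf (MvPolynomial.mem_support_iff.1 hd)]
  exact Submodule.smul_mem _ _ (prodSpan_le_schurSpan _ (monomial_mem_prodSpan d))

theorem finite_weight_eq (w : ℕ) : {d : ℕ →₀ ℕ | Finsupp.weight wt d = w}.Finite := by
  refine ((Finset.range w).finsupp fun _ => Finset.range (w + 1)).finite_toSet.subset ?_
  intro d hd
  have hd : Finsupp.weight wt d = w := hd
  rw [Finset.mem_coe, Finset.mem_finsupp_iff]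
  constructor
  · intro m hm
    have := Finsupp.le_weight_of_ne_zero' wt (Finsupp.mem_support_iff.1 hm)
    rw [Finset.mem_range]
    simp only [wt] at this hd
    omega
  · intro m _
    have := Finsupp.le_weight wt (s := m) (Nat.succ_ne_zero m) d
    rw [Finset.mem_range]
    omega

/-- The differences `λ_{m+1} - λ_{m+2}` of successive rows. -/
def rowDiff (lam : YoungDiagram) : ℕ →₀ ℕ :=
  Finsupp.onFinset (Finset.range (lam.colLen 0)) (fun m => lam.rowLen m - lam.rowLen (m + 1))
    fun m hm => by
      rw [Finset.mem_range]
      by_contra h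
      exact hm (by rw [rowLen_eq_zero (not_lt.1 h) le_rfl, Nat.zero_sub])

theorem rowDiff_injective : Function.Injective rowDiff := by
  intro lam mu h
  refine ext_rowLen ?_
  set K := max (lam.colLen 0) (mu.colLen 0) with hK
  intro i
  rcases le_total K i with hi | hi
  · rw [rowLen_eq_zero (le_max_left _ _) hi, rowLen_eq_zero (le_max_right _ _) hi]
  · induction hi using Nat.decreasingInduction with
    | self => rw [rowLen_eq_zero (le_max_left _ _) le_rfl, rowLen_eq_zero (le_max_right _ _) le_rfl]
    | of_succ m _ ih =>
      have h1 := DFunLike.congr_fun h m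
      have h2 := lam.rowLen_anti m (m + 1) (Nat.le_succ m)
      have h3 := mu.rowLen_anti m (m + 1) (Nat.le_succ m)
      simp only [rowDiff, Finsupp.onFinset_apply] at h1
      omega

/-- Summation by parts. With injectivity, this shows that there are at most as many partitions of
`w` as monomials of weight `w`. -/
theorem weight_rowDiff (lam : YoungDiagram) : Finsupp.weight wt (rowDiff lam) = lam.card := by
  have h : ∀ K, ∑ m ∈ Finset.range K, (lam.rowLen m - lam.rowLen (m + 1)) * (m + 1) +
      K * lam.rowLen K = ∑ m ∈ Finset.range K, lam.rowLen m := by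
    intro K
    induction K with
    | zero => simp
    | succ K ih =>
      have h2 := lam.rowLen_anti K (K + 1) (Nat.le_succ K)
      obtain ⟨e, he⟩ := Nat.exists_eq_add_of_le h2
      rw [Finset.sum_range_succ, Finset.sum_range_succ, ← ih, he, Nat.add_sub_cancel_left]
      ring
  have h' := h (lam.colLen 0)
  rw [rowLen_eq_zero le_rfl le_rfl, mul_zero, add_zero] at h'
  rw [card_eq_sum_rowLen le_rfl, ← Finset.sum_range fun i => lam.rowLen i, ← h',
    Finsupp.weight_apply, rowDiff, Finsupp.onFinset_sum]
  · rfl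
  · intro a
    simp

/-- A dimension count: the span contains all monomials of weight `w`, and these are at least as many
as the spanning Schur functions. -/
theorem linearIndependent_schur_of_card (w : ℕ) :
    LinearIndependent ℂ fun lam : {lam : YoungDiagram // lam.card = w} => schur lam := by
  have : Finite {lam : YoungDiagram // lam.card = w} := finite_card_eq w
  have : Finite {d : ℕ →₀ ℕ // Finsupp.weight wt d = w} := finite_weight_eq w
  have := Fintype.ofFinite {lam : YoungDiagram // lam.card = w}
  have := Fintype.ofFinite {d : ℕ →₀ ℕ // Finsupp.weight wt d = w}
  have hspan : Set.range (fun lam : {lam : YoungDiagram // lam.card = w} => schur lam) =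
      schur '' {lam | lam.card = w} := by
    rw [Set.image_eq_range]
    rfl
  have hmon : LinearIndependent ℂ fun d : {d : ℕ →₀ ℕ // Finsupp.weight wt d = w} =>
      MvPolynomial.monomial (d : ℕ →₀ ℕ) (1 : ℂ) := by
    have h := (MvPolynomial.basisMonomials ℕ ℂ).linearIndependent
    rw [MvPolynomial.coe_basisMonomials] at h
    exact h.comp _ Subtype.val_injective
  rw [linearIndependent_iff_card_eq_finrank_span]
  refine le_antisymm ?_ (finrank_range_le_card _)
  refine (Fintype.card_le_of_injective
    (fun lam : {lam : YoungDiagram // lam.card = w} =>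
      (⟨rowDiff lam, (weight_rowDiff lam).trans lam.2⟩ :
        {d : ℕ →₀ ℕ // Finsupp.weight wt d = w})) fun lam mu h =>
      Subtype.ext (rowDiff_injective (congrArg Subtype.val h))).trans ?_
  rw [← finrank_span_eq_card hmon]
  have : FiniteDimensional ℂ (Submodule.span ℂ
      (Set.range fun lam : {lam : YoungDiagram // lam.card = w} => schur lam)) :=
    FiniteDimensional.span_of_finite ℂ (Set.finite_range _)
  refine Submodule.finrank_mono (Submodule.span_le.2 ?_)
  rintro _ ⟨d, rfl⟩
  have h := prodSpan_le_schurSpan _ (monomial_mem_prodSpan (d : ℕ →₀ ℕ))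
  rw [d.2, schurSpan, ← hspan] at h
  exact h

theorem linearIndependent_schur : LinearIndependent ℂ schur := by
  rw [linearIndependent_iff']
  intro s g hg mu hmu
  have h := congrArg (MvPolynomial.weightedHomogeneousComponent wt mu.card) hg
  rw [map_sum, map_zero] at h
  have hcomp : ∀ lam : YoungDiagram,
      MvPolynomial.weightedHomogeneousComponent wt mu.card (g lam • schur lam) =
        if lam.card = mu.card then g lam • schur lam else 0 := by
    intro lam
    rw [map_smul]
    split_ifs with hl
    · rw [← hl, (isWeightedHomogeneous_schur lam).weightedHomogeneousComponent_same]
    · rw [(isWeightedHomogeneous_schur lam).weightedHomogeneousComponent_ne _ (Ne.symm hl), smul_zero]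
  rw [Finset.sum_congr rfl fun lam _ => hcomp lam, ← Finset.sum_filter,
    ← Finset.sum_subtype_eq_sum_filter] at h
  exact linearIndependent_iff'.1 (linearIndependent_schur_of_card mu.card) _
    (fun lam => g lam) h ⟨mu, rfl⟩ (Finset.mem_subtype.2 hmu)

end Spanning

/-! ### Expansions in Schur functions -/

section Expansion

/-- The weight `w` part of `∑_λ c_λ χ_λ`. -/
def schurPart (c : YoungDiagram → ℂ) (w : ℕ) : MvPolynomial ℕ ℂ :=
  ∑ lam ∈ diagrams w, c lam • schur lam

/-- A monomial occurs only in Schur functions of its own weight, so convergence is automatic and the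
infinite sum splits into finite sums by weight. -/
theorem isSchurExpansion_iff {τ : MvPowerSeries ℕ ℂ} {c : YoungDiagram → ℂ} :
    IsSchurExpansion τ c ↔ ∀ d, MvPowerSeries.coeff d τ =
      MvPolynomial.coeff d (schurPart c (Finsupp.weight wt d)) := by
  rw [IsSchurExpansion, MvPowerSeries.WithPiTopology.hasSum_iff_hasSum_coeff]
  refine forall_congr' fun d => ?_
  have h : HasSum (fun lam : YoungDiagram =>
      MvPowerSeries.coeff d (c lam • (schur lam : MvPowerSeries ℕ ℂ)))
      (MvPolynomial.coeff d (schurPart c (Finsupp.weight wt d))) := by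
    have h1 : MvPolynomial.coeff d (schurPart c (Finsupp.weight wt d)) =
        ∑ lam ∈ diagrams (Finsupp.weight wt d),
          MvPowerSeries.coeff d (c lam • (schur lam : MvPowerSeries ℕ ℂ)) := by
      rw [schurPart, MvPolynomial.coeff_sum]
      rfl
    rw [h1]
    refine hasSum_sum_of_ne_finset_zero fun lam hlam => ?_
    rw [mem_diagrams] at hlam
    rw [map_smul, MvPolynomial.coeff_coe,
      (isWeightedHomogeneous_schur lam).coeff_eq_zero d (Ne.symm hlam), smul_zero]
  exact ⟨fun h' => h'.unique h, fun h' => h' ▸ h⟩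

theorem exists_isSchurExpansion (τ : MvPowerSeries ℕ ℂ) : ∃ c, IsSchurExpansion τ c := by
  have h : ∀ w, ∃ c : YoungDiagram → ℂ, schurPart c w =
      ∑ d ∈ (finite_weight_eq w).toFinset, MvPolynomial.monomial d (MvPowerSeries.coeff d τ) := by
    intro w
    have hmem : ∑ d ∈ (finite_weight_eq w).toFinset,
        MvPolynomial.monomial d (MvPowerSeries.coeff d τ) ∈ schurSpan w := by
      refine mem_schurSpan_of_isWeightedHomogeneous ?_
      refine MvPolynomial.IsWeightedHomogeneous.sum _ _ _ fun d hd => ?_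
      exact MvPolynomial.isWeightedHomogeneous_monomial _ _ _ (by simpa using hd)
    rw [schurSpan, ← Set.Finite.coe_toFinset (finite_card_eq w)] at hmem
    exact Submodule.mem_span_image_finset_iff_exists_fun' ℂ |>.1 hmem
  choose c hc using h
  -- Each weight was solved with its own coefficient function; a partition takes its value from the
  -- one for its size.
  refine ⟨fun lam => c lam.card lam, isSchurExpansion_iff.2 fun d => ?_⟩
  have h1 : schurPart (fun lam => c lam.card lam) (Finsupp.weight wt d) =
      schurPart (c (Finsupp.weight wt d)) (Finsupp.weight wt d) :=
    Finset.sum_congr rfl fun lam hlam => by simp only [mem_diagrams.1 hlam]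
  rw [h1, hc, MvPolynomial.coeff_sum]
  simp only [MvPolynomial.coeff_monomial]
  rw [Finset.sum_ite_eq' , if_pos (by simp)]

theorem isSchurExpansion_unique {τ : MvPowerSeries ℕ ℂ} {c c' : YoungDiagram → ℂ}
    (h : IsSchurExpansion τ c) (h' : IsSchurExpansion τ c') : c = c' := by
  rw [isSchurExpansion_iff] at h h'
  funext lam
  have hhom : ∀ c : YoungDiagram → ℂ, (schurPart c lam.card).IsWeightedHomogeneous wt lam.card :=
    fun c => MvPolynomial.IsWeightedHomogeneous.sum _ _ _ fun mu hmu =>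
      Submodule.smul_mem (MvPolynomial.weightedHomogeneousSubmodule ℂ wt lam.card) _
        (mem_diagrams.1 hmu ▸ isWeightedHomogeneous_schur mu)
  have heq : schurPart c lam.card = schurPart c' lam.card := by
    ext d
    by_cases hd : Finsupp.weight wt d = lam.card
    · rw [← hd, ← h, ← h']
    · rw [(hhom c).coeff_eq_zero d hd, (hhom c').coeff_eq_zero d hd]
  have h0 : ∑ mu ∈ diagrams lam.card, (c mu - c' mu) • schur mu = 0 := by
    simp only [sub_smul, Finset.sum_sub_distrib]
    exact sub_eq_zero.2 heq
  exact sub_eq_zero.1 (linearIndependent_iff'.1 linearIndependent_schur _ _ h0 lam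
    (mem_diagrams.2 rfl))

end Expansion

/-! ### Substitution of homogeneous power series -/

section Homogeneous

variable {σ : Type*} {wσ : σ → ℕ}

variable (wσ) in
/-- The power series `f` is homogeneous of weight `n`. -/
def IsHomog (f : MvPowerSeries σ ℂ) (n : ℕ) : Prop :=
  ∀ d, Finsupp.weight wσ d ≠ n → MvPowerSeries.coeff d f = 0

theorem isHomog_one : IsHomog wσ 1 0 := by
  classical
  intro d hd
  rw [MvPowerSeries.coeff_one, if_neg]
  rintro rfl
  exact hd (map_zero _)

theorem IsHomog.smul {f : MvPowerSeries σ ℂ} {n : ℕ} (r : ℂ) (hf : IsHomog wσ f n) :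
    IsHomog wσ (r • f) n := fun d hd => by rw [map_smul, hf d hd, smul_zero]

theorem IsHomog.add {f g : MvPowerSeries σ ℂ} {n : ℕ} (hf : IsHomog wσ f n)
    (hg : IsHomog wσ g n) : IsHomog wσ (f + g) n :=
  fun d hd => by rw [map_add, hf d hd, hg d hd, add_zero]

theorem IsHomog.mul {f g : MvPowerSeries σ ℂ} {m n : ℕ} (hf : IsHomog wσ f m)
    (hg : IsHomog wσ g n) : IsHomog wσ (f * g) (m + n) := by
  classical
  intro d hd
  rw [MvPowerSeries.coeff_mul]
  refine Finset.sum_eq_zero fun e he => ?_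
  have he : e.1 + e.2 = d := by simpa using he
  by_cases h : Finsupp.weight wσ e.1 = m
  · rw [hg e.2 fun h' => hd (by rw [← he, map_add, h, h']), mul_zero]
  · rw [hf e.1 h, zero_mul]

theorem isHomog_X (s : σ) : IsHomog wσ (MvPowerSeries.X s) (wσ s) := by
  classical
  intro d hd
  rw [MvPowerSeries.coeff_X, if_neg]
  rintro rfl
  exact hd (by simp [Finsupp.weight_single])

theorem IsHomog.pow {f : MvPowerSeries σ ℂ} {n : ℕ} (hf : IsHomog wσ f n) (k : ℕ) :
    IsHomog wσ (f ^ k) (k * n) := by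
  induction k with
  | zero =>
    rw [pow_zero, zero_mul]
    exact isHomog_one
  | succ k ih =>
    rw [pow_succ, Nat.succ_mul]
    exact ih.mul hf

theorem isHomog_prod_pow {a : ℕ → MvPowerSeries σ ℂ} (ha : ∀ m, IsHomog wσ (a m) (wt m))
    (d : ℕ →₀ ℕ) : IsHomog wσ (d.prod fun m k => a m ^ k) (Finsupp.weight wt d) := by
  rw [Finsupp.weight_apply, Finsupp.sum, Finsupp.prod]
  induction d.support using Finset.induction_on with
  | empty => simpa using isHomog_one
  | insert m s hm ih =>
    rw [Finset.prod_insert hm, Finset.sum_insert hm]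
    exact ((ha m).pow _).mul ih

theorem hasSubst_of_isHomog {a : ℕ → MvPowerSeries σ ℂ} (ha : ∀ m, IsHomog wσ (a m) (wt m)) :
    MvPowerSeries.HasSubst a where
  const_coeff m := by
    rw [← MvPowerSeries.coeff_zero_eq_constantCoeff_apply, ha m 0 (by simp [wt])]
    exact IsNilpotent.zero
  coeff_zero d := by
    refine (Set.finite_le_nat (Finsupp.weight wσ d)).subset fun m hm => ?_
    have h : Finsupp.weight wσ d = wt m := by_contra fun h => hm (ha m d h)
    exact h ▸ Nat.le_succ m

/-- A substitution that preserves weights lets a coefficient depend only on the part of the same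
weight. This allows `τ` to be replaced by a polynomial. -/
theorem coeff_subst_congr {a : ℕ → MvPowerSeries σ ℂ}
    (ha : ∀ m, IsHomog wσ (a m) (wt m)) {f g : MvPowerSeries ℕ ℂ} {e : σ →₀ ℕ}
    (h : ∀ d, Finsupp.weight wt d = Finsupp.weight wσ e →
      MvPowerSeries.coeff d f = MvPowerSeries.coeff d g) :
    MvPowerSeries.coeff e (f.subst a) = MvPowerSeries.coeff e (g.subst a) := by
  have hs := hasSubst_of_isHomog ha
  rw [MvPowerSeries.coeff_subst hs, MvPowerSeries.coeff_subst hs]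
  refine finsum_congr fun d => ?_
  by_cases hd : Finsupp.weight wt d = Finsupp.weight wσ e
  · rw [h d hd]
  · rw [isHomog_prod_pow ha d e (Ne.symm hd), smul_zero, smul_zero]

theorem isHomog_aeval {a : ℕ → MvPowerSeries σ ℂ}
    (ha : ∀ m, IsHomog wσ (a m) (wt m)) {f : MvPolynomial ℕ ℂ} {n : ℕ}
    (hf : f.IsWeightedHomogeneous wt n) :
    IsHomog wσ (MvPolynomial.aeval a f) n := by
  intro e hne
  rw [← MvPowerSeries.subst_coe, coeff_subst_congr ha (g := 0)]
  · rw [← MvPolynomial.coe_zero, MvPowerSeries.subst_coe, map_zero, map_zero]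
  · intro d hd
    rw [MvPolynomial.coeff_coe, hf.coeff_eq_zero d (by rw [hd]; exact hne), map_zero]

theorem isWeightedHomogeneous_schurPart (c : YoungDiagram → ℂ) (w : ℕ) :
    (schurPart c w).IsWeightedHomogeneous wt w :=
  MvPolynomial.IsWeightedHomogeneous.sum _ _ _ fun mu hmu =>
    Submodule.smul_mem (MvPolynomial.weightedHomogeneousSubmodule ℂ wt w) _
      (mem_diagrams.1 hmu ▸ isWeightedHomogeneous_schur mu)

theorem coeff_subst_eq_coeff_aeval_schurPart {a : ℕ → MvPowerSeries σ ℂ}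
    (ha : ∀ m, IsHomog wσ (a m) (wt m)) {τ : MvPowerSeries ℕ ℂ}
    {c : YoungDiagram → ℂ} (hc : IsSchurExpansion τ c) (e : σ →₀ ℕ) :
    MvPowerSeries.coeff e (τ.subst a) =
      MvPowerSeries.coeff e (MvPolynomial.aeval a (schurPart c (Finsupp.weight wσ e))) := by
  rw [← MvPowerSeries.subst_coe]
  refine coeff_subst_congr ha fun d hd => ?_
  rw [isSchurExpansion_iff.1 hc, hd, MvPolynomial.coeff_coe]

end Homogeneous

/-! ### The weight components of the bilinear identity -/

section Bilinear

/-- The weights of the variables `x_m`, `y_m`. -/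
def wtXY : ℕ ⊕ ℕ → ℕ := Sum.elim wt wt

/-- The weights of the variables `x_m`, `y_m`, `z`. -/
def wtVar : Var → ℕ
  | none => 1
  | some s => wtXY s

theorem weight_optionElim (e : (ℕ ⊕ ℕ) →₀ ℕ) (b : ℕ) :
    Finsupp.weight wtVar (e.optionElim b) = Finsupp.weight wtXY e + b := by
  rw [Finsupp.weight_apply, Finsupp.weight_apply, Finsupp.sum_option_index]
  · rw [Finsupp.optionElim_apply_none, Finsupp.some_optionElim, add_comm]
    simp [wtVar]
  · simp
  · intros
    rw [add_smul]

/-- The series `x_m - y_m - z^m / m`. -/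
def argMinus (m : ℕ) : MvPowerSeries Var ℂ := x m - y m - br m

/-- The series `x_m + y_m + z^m / m`. -/
def argPlus (m : ℕ) : MvPowerSeries Var ℂ := x m + y m + br m

theorem isHomog_x (m : ℕ) : IsHomog wtVar (x m) (wt m) :=
  isHomog_X _

theorem isHomog_y (m : ℕ) : IsHomog wtVar (y m) (wt m) :=
  isHomog_X _

theorem isHomog_br (m : ℕ) : IsHomog wtVar (br m) (wt m) := by
  have h := (isHomog_X (wσ := wtVar) none).pow (m + 1)
  have h1 : (m + 1) * wtVar none = wt m := mul_one _
  rw [h1] at h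
  exact h.smul _

theorem isHomog_argPlus (m : ℕ) :
    IsHomog wtVar (argPlus m) (wt m) :=
  ((isHomog_x m).add (isHomog_y m)).add (isHomog_br m)

theorem isHomog_argMinus (m : ℕ) :
    IsHomog wtVar (argMinus m) (wt m) := by
  rw [argMinus, sub_eq_add_neg, sub_eq_add_neg, ← neg_one_smul ℂ (y m), ← neg_one_smul ℂ (br m)]
  exact ((isHomog_x m).add
    ((isHomog_y m).smul _)).add
    ((isHomog_br m).smul _)

/-- The variables `u_m = x_m - y_m`. -/
def uVar (m : ℕ) : MvPowerSeries (ℕ ⊕ ℕ) ℂ :=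
  MvPowerSeries.X (Sum.inl m) - MvPowerSeries.X (Sum.inr m)

/-- The variables `v_m = x_m + y_m`. -/
def vVar (m : ℕ) : MvPowerSeries (ℕ ⊕ ℕ) ℂ :=
  MvPowerSeries.X (Sum.inl m) + MvPowerSeries.X (Sum.inr m)

theorem expFactor_eq : expFactor = expXi (uVar - vVar) := by
  rw [expFactor, expXi]
  congr 1
  ext1 n
  cases n with
  | zero => simp [xi]
  | succ n =>
    rw [coeff_succ_xi, neg_mul, map_neg, two_mul, map_add, coeff_succ_xi]
    simp only [Pi.sub_apply, uVar, vVar]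
    ring

theorem isHomog_coeff_expFactor (a : ℕ) :
    IsHomog wtXY (PowerSeries.coeff a expFactor) a := by
  have h : PowerSeries.coeff a expFactor = MvPolynomial.aeval (uVar - vVar) (p a) := by
    rw [aeval_p, hval, zcoeff_natCast, expFactor_eq]
  rw [h]
  refine isHomog_aeval (fun m => ?_) (isWeightedHomogeneous_p a)
  have h : (uVar - vVar) m = (-2 : ℂ) • (MvPowerSeries.X (Sum.inr m) : MvPowerSeries (ℕ ⊕ ℕ) ℂ) := by
    simp only [Pi.sub_apply, uVar, vVar]
    module
  rw [h]
  exact (isHomog_X (wσ := wtXY) (Sum.inr m)).smul _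

/-- The weight `n` part of `τ(x - y - [z]) τ(x + y + [z])`. -/
def prodPart (c : YoungDiagram → ℂ) (n : ℕ) : MvPowerSeries Var ℂ :=
  ∑ ij ∈ Finset.HasAntidiagonal.antidiagonal n, MvPolynomial.aeval argMinus (schurPart c ij.1) *
    MvPolynomial.aeval argPlus (schurPart c ij.2)

theorem isHomog_prodPart (c : YoungDiagram → ℂ) (n : ℕ) :
    IsHomog wtVar (prodPart c n) n := by
  intro e he
  rw [prodPart, map_sum]
  refine Finset.sum_eq_zero fun ij hij => ?_
  have hij : ij.1 + ij.2 = n := by simpa using hij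
  exact ((isHomog_aeval isHomog_argMinus (isWeightedHomogeneous_schurPart c _)).mul
    (isHomog_aeval isHomog_argPlus (isWeightedHomogeneous_schurPart c _))) e (hij ▸ he)

theorem coeff_tauMinus_mul_tauPlus {τ : MvPowerSeries ℕ ℂ} {c : YoungDiagram → ℂ}
    (hc : IsSchurExpansion τ c) (e : Var →₀ ℕ) :
    MvPowerSeries.coeff e (tauMinus τ * tauPlus τ) =
      MvPowerSeries.coeff e (prodPart c (Finsupp.weight wtVar e)) := by
  classical
  rw [prodPart, map_sum]
  simp only [MvPowerSeries.coeff_mul]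
  rw [Finset.sum_comm]
  refine Finset.sum_congr rfl fun e' he' => ?_
  have he : e'.1 + e'.2 = e := by simpa using he'
  rw [Finset.sum_eq_single (Finsupp.weight wtVar e'.1, Finsupp.weight wtVar e'.2)]
  · congr 1
    · exact coeff_subst_eq_coeff_aeval_schurPart isHomog_argMinus hc _
    · exact coeff_subst_eq_coeff_aeval_schurPart isHomog_argPlus hc _
  · intro ij _ hij
    by_cases h1 : Finsupp.weight wtVar e'.1 = ij.1
    · rw [isHomog_aeval isHomog_argPlus (isWeightedHomogeneous_schurPart c _) _
        fun h2 => hij (Prod.ext h1.symm h2.symm), mul_zero]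
    · rw [isHomog_aeval isHomog_argMinus (isWeightedHomogeneous_schurPart c _) _ h1, zero_mul]
  · intro h
    exact absurd (by simp [← he]) h

/-- `prodPart` as a power series in `z`. -/
def prodPartZ (c : YoungDiagram → ℂ) (n : ℕ) : (MvPowerSeries (ℕ ⊕ ℕ) ℂ)⟦X⟧ :=
  MvPowerSeries.optionEquivLeft (ℕ ⊕ ℕ) ℂ (prodPart c n)

theorem coeff_coeff_tauProd {τ : MvPowerSeries ℕ ℂ} {c : YoungDiagram → ℂ}
    (hc : IsSchurExpansion τ c) (e : (ℕ ⊕ ℕ) →₀ ℕ) (b : ℕ) :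
    MvPowerSeries.coeff e (PowerSeries.coeff b (tauProd τ)) =
      MvPowerSeries.coeff e (PowerSeries.coeff b (prodPartZ c (Finsupp.weight wtXY e + b))) := by
  rw [tauProd, prodPartZ, MvPowerSeries.coeff_coeff_optionEquivLeft,
    MvPowerSeries.coeff_coeff_optionEquivLeft, coeff_tauMinus_mul_tauPlus hc, weight_optionElim]

theorem coeff_coeff_prodPartZ (c : YoungDiagram → ℂ) {n : ℕ} (e : (ℕ ⊕ ℕ) →₀ ℕ) (b : ℕ)
    (h : Finsupp.weight wtXY e + b ≠ n) :
    MvPowerSeries.coeff e (PowerSeries.coeff b (prodPartZ c n)) = 0 := by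
  rw [prodPartZ, MvPowerSeries.coeff_coeff_optionEquivLeft,
    isHomog_prodPart c n _ (by rwa [weight_optionElim])]

/-- The coefficient of `k^a` has weight `a` and is paired with that of `z^{a+1}`. So the relevant
weight of the product exceeds that of `e` by one, whatever `a` is, and one polynomial serves all
terms. -/
theorem coeff_mul_tauProd {τ : MvPowerSeries ℕ ℂ} {c : YoungDiagram → ℂ}
    (hc : IsSchurExpansion τ c) (e : (ℕ ⊕ ℕ) →₀ ℕ) (a : ℕ) :
    MvPowerSeries.coeff e (PowerSeries.coeff a expFactor * PowerSeries.coeff (a + 1) (tauProd τ)) =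
      MvPowerSeries.coeff e (PowerSeries.coeff a expFactor *
        PowerSeries.coeff (a + 1) (prodPartZ c (Finsupp.weight wtXY e + 1))) := by
  classical
  rw [MvPowerSeries.coeff_mul, MvPowerSeries.coeff_mul]
  refine Finset.sum_congr rfl fun e' he' => ?_
  have he : e'.1 + e'.2 = e := by simpa using he'
  by_cases h : Finsupp.weight wtXY e'.1 = a
  · rw [coeff_coeff_tauProd hc, ← he, map_add, h]
    congr 4
    ring
  · rw [isHomog_coeff_expFactor a _ h, zero_mul, zero_mul]

theorem coeff_mul_prodPartZ (c : YoungDiagram → ℂ) {n : ℕ} (e : (ℕ ⊕ ℕ) →₀ ℕ) (a : ℕ)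
    (h : Finsupp.weight wtXY e + 1 ≠ n) :
    MvPowerSeries.coeff e (PowerSeries.coeff a expFactor *
      PowerSeries.coeff (a + 1) (prodPartZ c n)) = 0 := by
  classical
  rw [MvPowerSeries.coeff_mul]
  refine Finset.sum_eq_zero fun e' he' => ?_
  have he : e'.1 + e'.2 = e := by simpa using he'
  by_cases h1 : Finsupp.weight wtXY e'.1 = a
  · rw [coeff_coeff_prodPartZ c, mul_zero]
    rw [← he, map_add, h1] at h
    omega
  · rw [isHomog_coeff_expFactor a _ h1, zero_mul]

theorem optionEquivLeft_argMinus (m : ℕ) : MvPowerSeries.optionEquivLeft (ℕ ⊕ ℕ) ℂ (argMinus m) =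
    ((fun m => PowerSeries.C (uVar m)) - bracket PowerSeries.X :
      ℕ → (MvPowerSeries (ℕ ⊕ ℕ) ℂ)⟦X⟧) m := by
  simp [argMinus, x, y, br, uVar, bracket]

theorem optionEquivLeft_argPlus (m : ℕ) : MvPowerSeries.optionEquivLeft (ℕ ⊕ ℕ) ℂ (argPlus m) =
    ((fun m => PowerSeries.C (vVar m)) + bracket PowerSeries.X :
      ℕ → (MvPowerSeries (ℕ ⊕ ℕ) ℂ)⟦X⟧) m := by
  simp [argPlus, x, y, br, vVar, bracket]

theorem aeval_jdet {A : Type*} [CommRing A] [Algebra ℂ A] (t : ℕ → A) {M : ℕ} (r : Fin M → ℕ) :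
    MvPolynomial.aeval t (jdet p r) = jdet (hval t) r := by
  have h := map_jdet (MvPolynomial.aeval t : MvPolynomial ℕ ℂ →ₐ[ℂ] A).toRingHom p r
  have h' : (fun k => MvPolynomial.aeval t (p k)) = hval t := funext fun k => aeval_p t k
  rw [← h']
  exact h

theorem optionEquivLeft_aeval_argMinus {M : ℕ} {lam : YoungDiagram} (h : lam.colLen 0 ≤ M) :
    MvPowerSeries.optionEquivLeft (ℕ ⊕ ℕ) ℂ (MvPolynomial.aeval argMinus (schur lam)) =
      jdetMinus uVar (lev lam M) := by
  rw [schur_eq_jdet h, jdetMinus, ← aeval_jdet]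
  refine (MvPolynomial.comp_aeval_apply argMinus
    (MvPowerSeries.optionEquivLeft (ℕ ⊕ ℕ) ℂ).toAlgHom _).trans ?_
  congr 2
  funext m
  exact optionEquivLeft_argMinus m

theorem optionEquivLeft_aeval_argPlus {M : ℕ} {lam : YoungDiagram} (h : lam.colLen 0 ≤ M) :
    MvPowerSeries.optionEquivLeft (ℕ ⊕ ℕ) ℂ (MvPolynomial.aeval argPlus (schur lam)) =
      jdetPlus vVar (lev lam M) := by
  rw [schur_eq_jdet h, jdetPlus, ← aeval_jdet]
  refine (MvPolynomial.comp_aeval_apply argPlus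
    (MvPowerSeries.optionEquivLeft (ℕ ⊕ ℕ) ℂ).toAlgHom _).trans ?_
  congr 2
  funext m
  exact optionEquivLeft_argPlus m

end Bilinear

/-! ### Reduction of the KP hierarchy to finite residue sums -/

section Bridge

/-- The coefficient of `k⁻¹` in `e^{ξ(u - v, k)} χ(u - [k⁻¹]) χ'(v + [k⁻¹])`, for the Jacobi–Trudi
determinants `χ`, `χ'` of the tuples `t`, `t'`. -/
def bilin {N : ℕ} (t t' : Fin (N + 1) → ℕ) : MvPowerSeries (ℕ ⊕ ℕ) ℂ :=
  ∑ i : Fin (N + 1), (-1) ^ (i : ℕ) * jdet (hval uVar) (Fin.cons (t' i) t : Fin (N + 2) → ℕ) *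
    jdet (hval vVar) (i.removeNth t')

/-- The weight `n - 1` part of the left hand side of the bilinear identity. -/
def residuePart (c : YoungDiagram → ℂ) (n N : ℕ) : MvPowerSeries (ℕ ⊕ ℕ) ℂ :=
  ∑ ij ∈ Finset.HasAntidiagonal.antidiagonal n, ∑ lam ∈ diagrams ij.1, ∑ mu ∈ diagrams ij.2,
    (c lam * c mu) • bilin (lev lam (N + 1)) (lev mu (N + 1))

/-- The condition `n ≤ N + 1` ensures that every partition involved has at most `N + 1` rows. -/
theorem prodPartZ_eq (c : YoungDiagram → ℂ) {n N : ℕ} (hn : n ≤ N + 1) :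
    prodPartZ c n = ∑ ij ∈ Finset.HasAntidiagonal.antidiagonal n, ∑ lam ∈ diagrams ij.1,
      ∑ mu ∈ diagrams ij.2, (c lam * c mu) •
        (jdetMinus uVar (lev lam (N + 1)) * jdetPlus vVar (lev mu (N + 1))) := by
  rw [prodPartZ, prodPart, map_sum]
  refine Finset.sum_congr rfl fun ij hij => ?_
  have hij : ij.1 + ij.2 = n := by simpa using hij
  rw [map_mul, schurPart, schurPart]
  simp only [map_sum, map_smul]
  rw [Finset.sum_mul_sum]
  refine Finset.sum_congr rfl fun lam hlam => Finset.sum_congr rfl fun mu hmu => ?_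
  have h1 := colLen_le_card lam
  have h2 := colLen_le_card mu
  rw [mem_diagrams] at hlam hmu
  rw [optionEquivLeft_aeval_argMinus (M := N + 1) (by omega),
    optionEquivLeft_aeval_argPlus (M := N + 1) (by omega), smul_mul_smul_comm]

theorem hasSum_coeff_prodPartZ (c : YoungDiagram → ℂ) {n N : ℕ} (hn : n ≤ N + 1)
    (e : (ℕ ⊕ ℕ) →₀ ℕ) :
    HasSum (fun a => MvPowerSeries.coeff e (PowerSeries.coeff a expFactor *
      PowerSeries.coeff (a + 1) (prodPartZ c n))) (MvPowerSeries.coeff e (residuePart c n N)) := by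
  have h : ∀ a, MvPowerSeries.coeff e (PowerSeries.coeff a expFactor *
      PowerSeries.coeff (a + 1) (prodPartZ c n)) =
      ∑ ij ∈ Finset.HasAntidiagonal.antidiagonal n, ∑ lam ∈ diagrams ij.1, ∑ mu ∈ diagrams ij.2,
        (c lam * c mu) * MvPowerSeries.coeff e (PowerSeries.coeff a expFactor *
          PowerSeries.coeff (a + 1)
            (jdetMinus uVar (lev lam (N + 1)) * jdetPlus vVar (lev mu (N + 1)))) := by
    intro a
    rw [prodPartZ_eq c hn]
    simp only [map_sum, Finset.mul_sum]
    refine Finset.sum_congr rfl fun ij _ => Finset.sum_congr rfl fun lam _ =>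
      Finset.sum_congr rfl fun mu _ => ?_
    have hs : ∀ (r : ℂ) (F : (MvPowerSeries (ℕ ⊕ ℕ) ℂ)⟦X⟧),
        PowerSeries.coeff (a + 1) (r • F) = r • PowerSeries.coeff (a + 1) F := fun _ _ => rfl
    rw [hs, mul_smul_comm, map_smul, smul_eq_mul]
  simp only [h, residuePart, map_sum]
  refine hasSum_sum fun ij _ => hasSum_sum fun lam _ => hasSum_sum fun mu _ => ?_
  rw [map_smul, smul_eq_mul]
  refine HasSum.mul_left _ ?_
  rw [expFactor_eq]
  exact MvPowerSeries.WithPiTopology.hasSum_iff_hasSum_coeff.1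
    (hasSum_residue uVar vVar (lev lam (N + 1)) (lev mu (N + 1))) e

theorem isKPSolution_iff_hasSum (τ : MvPowerSeries ℕ ℂ) : IsKPSolution τ ↔
    ∀ e, HasSum (fun a => MvPowerSeries.coeff e (PowerSeries.coeff a expFactor *
      PowerSeries.coeff (a + 1) (tauProd τ))) 0 := by
  let φ : ℕ ≃ {s : ℕ × ℕ // (s.1 : ℤ) - (s.2 : ℤ) = -1} :=
    { toFun := fun a => ⟨(a, a + 1), by push_cast; ring⟩
      invFun := fun s => s.1.1
      left_inv := fun a => rfl
      right_inv := fun s => by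
        obtain ⟨⟨a, b⟩, h⟩ := s
        simp only [Subtype.mk.injEq, Prod.mk.injEq, true_and]
        simp only at h
        omega }
  rw [IsKPSolution, HasLaurentCoeff, ← φ.hasSum_iff,
    MvPowerSeries.WithPiTopology.hasSum_iff_hasSum_coeff]
  rfl

/-- Taking the residue lowers the weight by one, so weight `w` of the identity comes from weight `w
+ 1` of the product; `w ≤ N` leaves enough rows for it. -/
theorem isKPSolution_iff_residuePart {τ : MvPowerSeries ℕ ℂ} {c : YoungDiagram → ℂ}
    (hc : IsSchurExpansion τ c) :
    IsKPSolution τ ↔ ∀ w N, w ≤ N → residuePart c (w + 1) N = 0 := by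
  rw [isKPSolution_iff_hasSum]
  simp only [coeff_mul_tauProd hc]
  constructor
  · intro h w N hwN
    ext e
    have h1 := hasSum_coeff_prodPartZ c (show w + 1 ≤ N + 1 by omega) e
    rw [map_zero]
    by_cases hw : Finsupp.weight wtXY e = w
    · rw [← hw] at h1 ⊢
      exact h1.unique (h e)
    · have h0 : ∀ a, MvPowerSeries.coeff e (PowerSeries.coeff a expFactor *
          PowerSeries.coeff (a + 1) (prodPartZ c (w + 1))) = 0 :=
        fun a => coeff_mul_prodPartZ c e a (by omega)
      simp only [h0] at h1
      exact h1.unique hasSum_zero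
  · intro h e
    have h1 := hasSum_coeff_prodPartZ c (le_refl (Finsupp.weight wtXY e + 1)) e
    rwa [h _ _ le_rfl, map_zero] at h1

end Bridge

/-! ### Strictly decreasing tuples with bounded entries -/

section Tuples

/-- The strictly decreasing `M`-tuples with entries less than `L`. -/
def tup (M L : ℕ) : Finset (Fin M → ℕ) := by
  classical
  exact (Fintype.piFinset fun _ => Finset.range L).filter StrictAnti

theorem mem_tup {M L : ℕ} {t : Fin M → ℕ} : t ∈ tup M L ↔ (∀ i, t i < L) ∧ StrictAnti t := by
  simp [tup]

/-- A partition of `n` has at most `n` rows, and its levels are at most `n + M - 1`, so the box is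
large enough. -/
theorem sum_diagrams_eq {A : Type*} [AddCommMonoid A] {n M L : ℕ} (hM : n ≤ M) (hL : n + M ≤ L)
    (f : YoungDiagram → A) :
    ∑ lam ∈ diagrams n, f lam = ∑ t ∈ tup M L, if (diag t).card = n then f (diag t) else 0 := by
  rw [← Finset.sum_filter]
  refine Finset.sum_nbij' (fun lam => lev lam M) (fun t => diag t) ?_ ?_ ?_ ?_ ?_
  · intro lam hlam
    rw [mem_diagrams] at hlam
    have h := (colLen_le_card lam).trans (hlam.le.trans hM)
    rw [Finset.mem_filter, mem_tup, diag_lev h]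
    refine ⟨⟨fun i => ?_, strictAnti_lev lam M⟩, hlam⟩
    have h1 := rowLen_le_card lam i
    have h2 := i.2
    simp only [lev]
    omega
  · intro t ht
    exact mem_diagrams.2 (Finset.mem_filter.1 ht).2
  · intro lam hlam
    rw [mem_diagrams] at hlam
    exact diag_lev ((colLen_le_card lam).trans (hlam.le.trans hM))
  · intro t ht
    exact lev_diag (mem_tup.1 (Finset.mem_filter.1 ht).1).2
  · intro lam hlam
    rw [mem_diagrams] at hlam
    simp only [diag_lev ((colLen_le_card lam).trans (hlam.le.trans hM))]

/-- The sum of the levels of the empty partition. -/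
def vacSum (M : ℕ) : ℕ := ∑ i : Fin M, (M - 1 - i : ℕ)

theorem residuePart_eq_sum_tup (c : YoungDiagram → ℂ) {n N L : ℕ} (hN : n ≤ N + 1)
    (hL : n + (N + 1) ≤ L) :
    residuePart c n N = ∑ t ∈ tup (N + 1) L, ∑ t' ∈ tup (N + 1) L,
      if ∑ i, t i + ∑ i, t' i = n + 2 * vacSum (N + 1) then
        (c (diag t) * c (diag t')) • bilin t t' else 0 := by
  have h1 : residuePart c n N = ∑ ij ∈ Finset.HasAntidiagonal.antidiagonal n,
      ∑ t ∈ tup (N + 1) L, ∑ t' ∈ tup (N + 1) L,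
        if (diag t).card = ij.1 ∧ (diag t').card = ij.2 then
          (c (diag t) * c (diag t')) • bilin t t' else 0 := by
    refine Finset.sum_congr rfl fun ij hij => ?_
    have hij : ij.1 + ij.2 = n := by simpa using hij
    rw [sum_diagrams_eq (M := N + 1) (L := L) (by omega) (by omega)]
    refine Finset.sum_congr rfl fun t ht => ?_
    rw [sum_diagrams_eq (M := N + 1) (L := L) (by omega) (by omega)]
    rw [lev_diag (mem_tup.1 ht).2]
    split_ifs with h
    · refine Finset.sum_congr rfl fun t' ht' => ?_
      simp only [h, true_and, lev_diag (mem_tup.1 ht').2]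
    · simp [h]
  rw [h1, Finset.sum_comm]
  refine Finset.sum_congr rfl fun t ht => ?_
  rw [Finset.sum_comm]
  refine Finset.sum_congr rfl fun t' ht' => ?_
  have ht := (mem_tup.1 ht).2
  have ht' := (mem_tup.1 ht').2
  have hs := sum_lev (colLen_diag_le ht)
  have hs' := sum_lev (colLen_diag_le ht')
  rw [lev_diag ht] at hs
  rw [lev_diag ht'] at hs'
  have hiff : ∑ i, t i + ∑ i, t' i = n + 2 * vacSum (N + 1) ↔
      (diag t).card + (diag t').card = n := by
    rw [hs, hs', ← vacSum]
    omega
  simp only [hiff]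
  split_ifs with h
  · rw [Finset.sum_eq_single ((diag t).card, (diag t').card)]
    · simp
    · rintro ⟨i, j⟩ _ hne
      rw [if_neg]
      rintro ⟨rfl, rfl⟩
      exact hne rfl
    · intro hnot
      exact absurd (by simpa using h) hnot
  · refine Finset.sum_eq_zero fun ij hij => if_neg ?_
    rintro ⟨h1, h2⟩
    exact h (by rw [h1, h2]; simpa using hij)

theorem strictAnti_unique {M : ℕ} {s t : Fin M → ℕ} (hs : StrictAnti s) (ht : StrictAnti t)
    (h : Set.range s = Set.range t) : s = t := by
  have hs' : StrictMono (s ∘ Fin.rev) := hs.comp Fin.rev_strictAnti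
  have ht' : StrictMono (t ∘ Fin.rev) := ht.comp Fin.rev_strictAnti
  have h' := (StrictMono.range_inj hs' ht').1 (by
    rw [Fin.rev_surjective.range_comp, Fin.rev_surjective.range_comp, h])
  exact Fin.rev_surjective.injective_comp_right h'

theorem strictAnti_removeNth {M : ℕ} {t : Fin (M + 1) → ℕ} (ht : StrictAnti t) (i : Fin (M + 1)) :
    StrictAnti (i.removeNth t : Fin M → ℕ) := ht.comp_strictMono (Fin.strictMono_succAbove i)

theorem range_eq_insert {M : ℕ} (t : Fin (M + 1) → ℕ) (i : Fin (M + 1)) :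
    Set.range t = insert (t i) (Set.range (i.removeNth t : Fin M → ℕ)) := by
  conv_lhs => rw [← Fin.insertNth_self_removeNth i t]
  exact Fin.range_insertNth _ _ _

theorem eq_of_removeNth_eq {M : ℕ} {s t : Fin (M + 1) → ℕ} (hs : StrictAnti s) (ht : StrictAnti t)
    {i j : Fin (M + 1)} (h : s i = t j) (h' : (i.removeNth s : Fin M → ℕ) = j.removeNth t) :
    s = t ∧ i = j := by
  have hst : s = t := strictAnti_unique hs ht (by rw [range_eq_insert s i, range_eq_insert t j, h, h'])
  subst hst
  exact ⟨rfl, hs.injective h⟩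

theorem exists_insert {M : ℕ} {t : Fin M → ℕ} (ht : StrictAnti t) {n : ℕ} (hn : n ∉ Set.range t) :
    ∃ (s : Fin (M + 1) → ℕ) (i : Fin (M + 1)), StrictAnti s ∧ s i = n ∧ i.removeNth s = t := by
  classical
  have hn' : n ∉ Finset.univ.image t := by simpa using hn
  have hcard : (insert n (Finset.univ.image t)).card = M + 1 := by
    rw [Finset.card_insert_of_notMem hn', Finset.card_image_of_injective _ ht.injective,
      Finset.card_univ, Fintype.card_fin]
  set e := (insert n (Finset.univ.image t)).orderEmbOfFin hcard with he
  have hanti : StrictAnti (e ∘ Fin.rev) := e.strictMono.comp_strictAnti Fin.rev_strictAnti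
  have hrange : Set.range (e ∘ Fin.rev) = insert n (Set.range t) := by
    rw [Fin.rev_surjective.range_comp, he, Finset.range_orderEmbOfFin]
    simp
  obtain ⟨i, hi⟩ : n ∈ Set.range (e ∘ Fin.rev) := hrange ▸ Set.mem_insert _ _
  refine ⟨e ∘ Fin.rev, i, hanti, hi, strictAnti_unique (strictAnti_removeNth hanti i) ht ?_⟩
  have h1 := range_eq_insert (e ∘ Fin.rev) i
  rw [hrange, hi] at h1
  have h2 : n ∉ Set.range (i.removeNth (e ∘ Fin.rev) : Fin M → ℕ) := by
    rintro ⟨j, hj⟩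
    exact Fin.succAbove_ne i j (hanti.injective (hj.trans hi.symm))
  rw [← Set.insert_sdiff_self_of_notMem h2, ← h1, Set.insert_sdiff_self_of_notMem hn]

theorem apply_notMem_range_removeNth {M : ℕ} {t : Fin (M + 1) → ℕ} (ht : StrictAnti t)
    (i : Fin (M + 1)) : t i ∉ Set.range (i.removeNth t : Fin M → ℕ) := by
  rintro ⟨j, hj⟩
  exact Fin.succAbove_ne i j (ht.injective hj)

/-- A sum over a level `n` and a tuple not containing it is a sum over a tuple and one of its
entries. -/
theorem sum_insert_eq_sum_remove {A : Type*} [AddCommMonoid A] (M L : ℕ)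
    (f : ℕ → (Fin M → ℕ) → A) (hf : ∀ n t, n ∈ Set.range t → f n t = 0) :
    ∑ n ∈ Finset.range L, ∑ t ∈ tup M L, f n t =
      ∑ s ∈ tup (M + 1) L, ∑ i, f (s i) (i.removeNth s) := by
  classical
  rw [← Finset.sum_product', ← Finset.sum_product']
  symm
  refine Finset.sum_of_injOn (fun si : (Fin (M + 1) → ℕ) × Fin (M + 1) =>
    (si.1 si.2, (si.2.removeNth si.1 : Fin M → ℕ))) ?_ ?_ ?_ ?_
  · rintro ⟨s, i⟩ hs ⟨s', i'⟩ hs' h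
    have hs := (mem_tup.1 (Finset.mem_product.1 hs).1).2
    have hs' := (mem_tup.1 (Finset.mem_product.1 hs').1).2
    obtain ⟨h1, h2⟩ := Prod.mk.inj h
    obtain ⟨rfl, rfl⟩ := eq_of_removeNth_eq hs hs' h1 h2
    rfl
  · rintro ⟨s, i⟩ hs
    have hs := mem_tup.1 (Finset.mem_product.1 hs).1
    exact Finset.mem_product.2 ⟨Finset.mem_range.2 (hs.1 i),
      mem_tup.2 ⟨fun j => hs.1 _, strictAnti_removeNth hs.2 i⟩⟩
  · rintro ⟨n, t⟩ hnt hnot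
    refine hf n t (by_contra fun hn => hnot ?_)
    obtain ⟨h1, h2⟩ := Finset.mem_product.1 hnt
    obtain ⟨h3, h4⟩ := mem_tup.1 h2
    obtain ⟨s, i, hs, hsi, hst⟩ := exists_insert h4 hn
    refine ⟨(s, i), Finset.mem_product.2 ⟨mem_tup.2 ⟨fun j => ?_, hs⟩, Finset.mem_univ _⟩,
      Prod.ext hsi hst⟩
    rcases eq_or_ne j i with rfl | hj
    · exact hsi.trans_lt (Finset.mem_range.1 h1)
    · obtain ⟨k, rfl⟩ := Fin.exists_succAbove_eq hj
      have := h3 k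
      rwa [← hst] at this
  · intro _ _
    rfl

end Tuples

/-! ### The bilinear identity as a system of Plücker relations -/

section Plucker

open scoped TensorProduct in
-- Products in two disjoint sets of variables are independent, being pure tensors of independent
-- families. The map `(x, y) ↦ (x - y, x + y)` is an invertible change of variables over `ℂ`, with
-- inverse `φ`.
theorem linearIndependent_schur_mul_schur : LinearIndependent ℂ
    fun i : YoungDiagram × YoungDiagram =>
      MvPolynomial.aeval uVar (schur i.1) * MvPolynomial.aeval vVar (schur i.2) := by
  set ψ : MvPolynomial (ℕ ⊕ ℕ) ℂ →ₐ[ℂ] MvPolynomial (ℕ ⊕ ℕ) ℂ := MvPolynomial.aeval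
    (Sum.elim (fun m => MvPolynomial.X (Sum.inl m) - MvPolynomial.X (Sum.inr m))
      fun m => MvPolynomial.X (Sum.inl m) + MvPolynomial.X (Sum.inr m)) with hψ
  set φ : MvPolynomial (ℕ ⊕ ℕ) ℂ →ₐ[ℂ] MvPolynomial (ℕ ⊕ ℕ) ℂ := MvPolynomial.aeval
    (Sum.elim
      (fun m => (2⁻¹ : ℂ) • (MvPolynomial.X (Sum.inl m) + MvPolynomial.X (Sum.inr m)))
      fun m => (2⁻¹ : ℂ) • (MvPolynomial.X (Sum.inr m) - MvPolynomial.X (Sum.inl m))) with hφ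
  have hφψ : φ.comp ψ = AlgHom.id ℂ _ := by
    refine MvPolynomial.algHom_ext fun s => ?_
    rcases s with m | m
    · simp only [hφ, hψ, AlgHom.comp_apply, MvPolynomial.aeval_X, Sum.elim_inl, Sum.elim_inr,
        map_sub, AlgHom.id_apply]
      module
    · simp only [hφ, hψ, AlgHom.comp_apply, MvPolynomial.aeval_X, Sum.elim_inl, Sum.elim_inr,
        map_add, AlgHom.id_apply]
      module
  have hinj : Function.Injective ψ := fun a b h => by
    have h' := congrArg φ h
    have hid := fun a => AlgHom.congr_fun hφψ a
    simp only [AlgHom.comp_apply, AlgHom.id_apply] at hid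
    rwa [hid, hid] at h'
  set Ψ : MvPolynomial ℕ ℂ ⊗[ℂ] MvPolynomial ℕ ℂ →ₐ[ℂ] MvPowerSeries (ℕ ⊕ ℕ) ℂ :=
    (MvPolynomial.coeToMvPowerSeries.algHom ℂ).comp
      (ψ.comp (MvPolynomial.tensorEquivSum ℂ ℕ ℕ ℂ).toAlgHom) with hΨ
  have hΨinj : Function.Injective Ψ := by
    rw [hΨ]
    have h1 : Function.Injective (MvPolynomial.coeToMvPowerSeries.algHom ℂ :
        MvPolynomial (ℕ ⊕ ℕ) ℂ →ₐ[ℂ] MvPowerSeries (ℕ ⊕ ℕ) ℂ) := by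
      intro a b h
      rw [MvPolynomial.coeToMvPowerSeries.algHom_apply,
        MvPolynomial.coeToMvPowerSeries.algHom_apply] at h
      simpa using h
    exact h1.comp (hinj.comp (MvPolynomial.tensorEquivSum ℂ ℕ ℕ ℂ).injective)
  have hL : Ψ.comp Algebra.TensorProduct.includeLeft = MvPolynomial.aeval uVar := by
    refine MvPolynomial.algHom_ext fun m => ?_
    have : (MvPowerSeries.X (Sum.inl m) - MvPowerSeries.X (Sum.inr m) :
        MvPowerSeries (ℕ ⊕ ℕ) ℂ) = MvPolynomial.coeToMvPowerSeries.ringHom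
          (MvPolynomial.X (Sum.inl m) - MvPolynomial.X (Sum.inr m)) := by
      rw [map_sub]
      simp
    simp [hΨ, hψ, uVar, this]
  have hR : Ψ.comp Algebra.TensorProduct.includeRight = MvPolynomial.aeval vVar := by
    refine MvPolynomial.algHom_ext fun m => ?_
    simp [hΨ, hψ, vVar]
  have h := (linearIndependent_schur.tmul_of_isDomain linearIndependent_schur).map'
    Ψ.toLinearMap (LinearMap.ker_eq_bot.2 hΨinj)
  have heq : (fun i : YoungDiagram × YoungDiagram =>
      MvPolynomial.aeval uVar (schur i.1) * MvPolynomial.aeval vVar (schur i.2)) =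
      Ψ.toLinearMap ∘ fun i => schur i.1 ⊗ₜ[ℂ] schur i.2 := by
    funext i
    rw [← hL, ← hR]
    simp only [AlgHom.comp_apply, Algebra.TensorProduct.includeLeft_apply,
      Algebra.TensorProduct.includeRight_apply, ← map_mul, Algebra.TensorProduct.tmul_mul_tmul,
      one_mul, mul_one]
    rfl
  rw [heq]
  exact h

variable {N : ℕ}

/-- The antisymmetric extension of the coefficients `c` to tuples `(n, t)` with `t` strictly
decreasing. -/
def ins (c : (Fin (N + 1) → ℕ) → ℂ) (n : ℕ) (t : Fin N → ℕ) : ℂ := by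
  classical
  exact if h : ∃ si : (Fin (N + 1) → ℕ) × Fin (N + 1),
    StrictAnti si.1 ∧ si.1 si.2 = n ∧ si.2.removeNth si.1 = t
  then (-1) ^ (h.choose.2 : ℕ) * c h.choose.1 else 0

/-- The pair `(s, i)` is determined by the inserted level and the remaining tuple, so the choice
made in `ins` is harmless. -/
theorem ins_removeNth (c : (Fin (N + 1) → ℕ) → ℂ) {s : Fin (N + 1) → ℕ} (hs : StrictAnti s)
    (i : Fin (N + 1)) : ins c (s i) (i.removeNth s) = (-1) ^ (i : ℕ) * c s := by
  have h : ∃ si : (Fin (N + 1) → ℕ) × Fin (N + 1), StrictAnti si.1 ∧ si.1 si.2 = s i ∧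
      (si.2.removeNth si.1 : Fin N → ℕ) = i.removeNth s := ⟨(s, i), hs, rfl, rfl⟩
  rw [ins, dif_pos h]
  obtain ⟨h1, h2, h3⟩ := h.choose_spec
  obtain ⟨h4, h5⟩ := eq_of_removeNth_eq h1 hs h2 h3
  rw [h4, h5]

theorem ins_of_mem (c : (Fin (N + 1) → ℕ) → ℂ) {n : ℕ} {t : Fin N → ℕ} (hn : n ∈ Set.range t) :
    ins c n t = 0 := by
  rw [ins, dif_neg]
  rintro ⟨⟨s, i⟩, hs, h1, h2⟩
  have h1 : s i = n := h1
  have h2 : (i.removeNth s : Fin N → ℕ) = t := h2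
  have h3 : s i ∉ Set.range (i.removeNth s : Fin N → ℕ) := apply_notMem_range_removeNth hs i
  rw [h1, h2] at h3
  exact h3 hn

/-- The left hand side of the Plücker relation for `c` indexed by `α` and `β`. -/
def pluckerSum (c : (Fin (N + 1) → ℕ) → ℂ) (α : Fin (N + 2) → ℕ) (β : Fin N → ℕ) : ℂ :=
  ∑ i : Fin (N + 2), (-1) ^ (i : ℕ) * c (i.removeNth α) * ins c (α i) β

/-- Moving row `i` to the top costs the sign `(-1)^i`; the Laplace expansions of both sides along
that row agree. -/
theorem det_cons_removeNth {A : Type*} [CommRing A] {M : ℕ} (G : ℕ → Fin (M + 1) → A)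
    (s : Fin (M + 1) → ℕ) (i : Fin (M + 1)) :
    Matrix.det (Matrix.of fun a => G ((Fin.cons (s i) (i.removeNth s) : Fin (M + 1) → ℕ) a)) =
      (-1) ^ (i : ℕ) * Matrix.det (Matrix.of fun a => G (s a)) := by
  rw [Matrix.det_succ_row_zero, Matrix.det_succ_row _ i, Finset.mul_sum]
  refine Finset.sum_congr rfl fun j _ => ?_
  have h : ((-1 : A) ^ (i : ℕ)) * (-1) ^ ((i : ℕ) + j) = (-1) ^ (j : ℕ) := by
    rw [pow_add, ← mul_assoc, ← pow_add, ← two_mul, pow_mul]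
    simp
  rw [← mul_assoc, ← mul_assoc, h]
  rfl

theorem jdet_cons_removeNth {A : Type*} [CommRing A] (h : ℤ → A) {M : ℕ} (s : Fin (M + 1) → ℕ)
    (i : Fin (M + 1)) : jdet h (Fin.cons (s i) (i.removeNth s) : Fin (M + 1) → ℕ) =
      (-1) ^ (i : ℕ) * jdet h s :=
  det_cons_removeNth (fun n j => h ((n : ℤ) - (M + 1 : ℕ) + 1 + (j : ℕ))) s i

theorem jdet_cons_eq_zero {A : Type*} [CommRing A] (h : ℤ → A) {M : ℕ} {t : Fin M → ℕ} {n : ℕ}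
    (hn : n ∈ Set.range t) : jdet h (Fin.cons n t : Fin (M + 1) → ℕ) = 0 := by
  obtain ⟨j, rfl⟩ := hn
  refine Matrix.det_zero_of_row_eq (i := 0) (j := j.succ) (Fin.succ_ne_zero j).symm ?_
  funext k
  simp

theorem sum_removeNth {M : ℕ} (s : Fin (M + 1) → ℕ) (i : Fin (M + 1)) :
    s i + ∑ j, (i.removeNth s : Fin M → ℕ) j = ∑ j, s j := (Fin.sum_univ_succAbove s i).symm

/-- The sum over pairs of tuples, rewritten as a sum of Plücker relations. -/
theorem sum_bilin_eq (c : (Fin (N + 1) → ℕ) → ℂ) (L K : ℕ) :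
    ∑ t ∈ tup (N + 1) L, ∑ t' ∈ tup (N + 1) L,
      (if ∑ i, t i + ∑ i, t' i = K then (c t * c t') • bilin t t' else 0) =
    ∑ α ∈ tup (N + 2) L, ∑ β ∈ tup N L, if ∑ i, α i + ∑ i, β i = K then
      pluckerSum c α β • (jdet (hval uVar) α * jdet (hval vVar) β) else 0 := by
  -- Here `n` is the level that moves: `t'` is `β` with `n` inserted, and `α` will be `t` with `n`
  -- inserted. Exchanging the sums groups the terms by `(α, β)`.
  set F : (Fin N → ℕ) → ℕ → (Fin (N + 1) → ℕ) → MvPowerSeries (ℕ ⊕ ℕ) ℂ := fun β n t =>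
    if ∑ i, t i + (n + ∑ i, β i) = K then (c t * ins c n β) •
      (jdet (hval uVar) (Fin.cons n t : Fin (N + 2) → ℕ) * jdet (hval vVar) β) else 0 with hF
  have h1 : ∀ t, ∑ t' ∈ tup (N + 1) L,
      (if ∑ i, t i + ∑ i, t' i = K then (c t * c t') • bilin t t' else 0) =
      ∑ n ∈ Finset.range L, ∑ β ∈ tup N L, F β n t := by
    intro t
    rw [sum_insert_eq_sum_remove N L fun n β => F β n t]
    · refine Finset.sum_congr rfl fun t' ht' => ?_
      simp only [hF, sum_removeNth, ins_removeNth c (mem_tup.1 ht').2]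
      split_ifs
      · rw [bilin, Finset.smul_sum]
        refine Finset.sum_congr rfl fun i _ => ?_
        simp only [Algebra.smul_def, map_mul, map_pow, map_neg, map_one]
        ring
      · simp
    · intro n β hn
      simp [hF, ins_of_mem c hn]
  rw [Finset.sum_congr rfl fun t _ => h1 t]
  have h2 : ∑ t ∈ tup (N + 1) L, ∑ n ∈ Finset.range L, ∑ β ∈ tup N L, F β n t =
      ∑ β ∈ tup N L, ∑ n ∈ Finset.range L, ∑ t ∈ tup (N + 1) L, F β n t := by
    rw [Finset.sum_comm]
    rw [Finset.sum_congr rfl fun n _ => Finset.sum_comm]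
    rw [Finset.sum_comm]
  rw [h2]
  have h3 : ∀ β, ∑ n ∈ Finset.range L, ∑ t ∈ tup (N + 1) L, F β n t = ∑ α ∈ tup (N + 2) L,
      if ∑ i, α i + ∑ i, β i = K then
      pluckerSum c α β • (jdet (hval uVar) α * jdet (hval vVar) β) else 0 := by
    intro β
    rw [sum_insert_eq_sum_remove (N + 1) L (F β)]
    · refine Finset.sum_congr rfl fun α _ => ?_
      have hs : ∀ i : Fin (N + 2), ∑ j, (i.removeNth α : Fin (N + 1) → ℕ) j + (α i + ∑ j, β j) =
          ∑ j, α j + ∑ j, β j := fun i => by rw [← sum_removeNth α i]; ring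
      simp only [hF, hs, jdet_cons_removeNth]
      split_ifs
      · rw [pluckerSum, Finset.sum_smul]
        refine Finset.sum_congr rfl fun i _ => ?_
        simp only [Algebra.smul_def, map_mul, map_pow, map_neg, map_one]
        ring
      · simp
    · intro n t hn
      simp [hF, jdet_cons_eq_zero _ hn]
  rw [Finset.sum_congr rfl fun β _ => h3 β, Finset.sum_comm]

end Plucker

/-! ### KP hierarchy and Plücker relations -/

section PluckerIff

theorem residuePart_eq_sum_pluckerSum (c : YoungDiagram → ℂ) {n N L : ℕ} (hN : n ≤ N + 1)
    (hL : n + (N + 1) ≤ L) :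
    residuePart c n N = ∑ α ∈ tup (N + 2) L, ∑ β ∈ tup N L,
      if ∑ i, α i + ∑ i, β i = n + 2 * vacSum (N + 1) then
        pluckerSum (fun t => c (diag t)) α β •
          (jdet (hval uVar) α * jdet (hval vVar) β) else 0 := by
  rw [residuePart_eq_sum_tup c hN hL]
  exact sum_bilin_eq (fun t => c (diag t)) L _

theorem isKPSolution_of_pluckerSum {τ : MvPowerSeries ℕ ℂ} {c : YoungDiagram → ℂ}
    (hc : IsSchurExpansion τ c)
    (h : ∀ (N : ℕ) (α : Fin (N + 2) → ℕ) (β : Fin N → ℕ), StrictAnti α → StrictAnti β →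
      pluckerSum (fun t => c (diag t)) α β = 0) : IsKPSolution τ := by
  refine (isKPSolution_iff_residuePart hc).2 fun w N hw => ?_
  rw [residuePart_eq_sum_pluckerSum c (show w + 1 ≤ N + 1 by omega) le_rfl]
  refine Finset.sum_eq_zero fun α hα => Finset.sum_eq_zero fun β hβ => ?_
  rw [h N α β (mem_tup.1 hα).2 (mem_tup.1 hβ).2, zero_smul, ite_self]

theorem linearIndepOn_jdet_mul_jdet (M N L : ℕ) : LinearIndepOn ℂ
    (fun ab : (Fin M → ℕ) × (Fin N → ℕ) => jdet (hval uVar) ab.1 * jdet (hval vVar) ab.2)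
    (tup M L ×ˢ tup N L : Finset _) := by
  have hmem : ∀ x : (tup M L ×ˢ tup N L : Finset ((Fin M → ℕ) × (Fin N → ℕ))),
      StrictAnti x.1.1 ∧ StrictAnti x.1.2 := fun x =>
    ⟨(mem_tup.1 (Finset.mem_product.1 x.2).1).2, (mem_tup.1 (Finset.mem_product.1 x.2).2).2⟩
  have h := linearIndependent_schur_mul_schur.comp
    (fun x : (tup M L ×ˢ tup N L : Finset ((Fin M → ℕ) × (Fin N → ℕ))) =>
      (diag x.1.1, diag x.1.2)) (fun x y hxy => by
        obtain ⟨h1, h2⟩ := Prod.mk.inj hxy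
        refine Subtype.ext (Prod.ext ?_ ?_)
        · rw [← lev_diag (hmem x).1, h1, lev_diag (hmem y).1]
        · rw [← lev_diag (hmem x).2, h2, lev_diag (hmem y).2])
  refine (linearIndependent_equiv' (Equiv.refl _) ?_).2 h
  funext x
  simp only [Function.comp_apply, Equiv.refl_apply, schur_diag (hmem x).1, schur_diag (hmem x).2,
    aeval_jdet]

/-- The residue is a combination of linearly independent products, so each coefficient vanishes.
Only relations of weight at most `N` are obtained, since the reduction to `N + 1` rows needs this
bound. -/
theorem pluckerSum_eq_zero {τ : MvPowerSeries ℕ ℂ} {c : YoungDiagram → ℂ}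
    (hc : IsSchurExpansion τ c) (h : IsKPSolution τ) {w N : ℕ} (hw : w ≤ N)
    {α : Fin (N + 2) → ℕ} {β : Fin N → ℕ} (hα : StrictAnti α) (hβ : StrictAnti β)
    (hs : ∑ i, α i + ∑ i, β i = w + 1 + 2 * vacSum (N + 1)) :
    pluckerSum (fun t => c (diag t)) α β = 0 := by
  -- Large enough for the truncation and for all entries of `α` and `β`.
  set L := w + 1 + (N + 1) + ∑ i, α i + ∑ i, β i + 1 with hL
  have h0 := (isKPSolution_iff_residuePart hc).1 h w N hw
  rw [residuePart_eq_sum_pluckerSum c (show w + 1 ≤ N + 1 by omega)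
    (show w + 1 + (N + 1) ≤ L by omega), ← Finset.sum_product'] at h0
  have h1 := linearIndepOn_finset_iff.1 (linearIndepOn_jdet_mul_jdet (N + 2) N L)
    (fun ab => if ∑ i, ab.1 i + ∑ i, ab.2 i = w + 1 + 2 * vacSum (N + 1) then
      pluckerSum (fun t => c (diag t)) ab.1 ab.2 else 0) (by simpa only [ite_smul, zero_smul])
    (α, β) (Finset.mem_product.2 ⟨mem_tup.2 ⟨fun i => ?_, hα⟩, mem_tup.2 ⟨fun i => ?_, hβ⟩⟩)
  · simpa only [if_pos hs] using h1
  · change α i < L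
    have : α i ≤ ∑ i, α i := Finset.single_le_sum (fun _ _ => Nat.zero_le _) (Finset.mem_univ i)
    omega
  · change β i < L
    have : β i ≤ ∑ i, β i := Finset.single_le_sum (fun _ _ => Nat.zero_le _) (Finset.mem_univ i)
    omega

end PluckerIff

/-! ### Levels of a partition in Frobenius notation -/

section Frobenius

variable {n : ℕ} {k l : Fin n → ℕ} (hk : StrictAnti k) (hl : StrictAnti l)

theorem mem_frobenius {a b : ℕ} : (a, b) ∈ frobenius k l hk hl ↔
    ∃ i : Fin n, (i : ℕ) = min a b ∧ a ≤ i + l i ∧ b ≤ i + k i := by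
  rw [← YoungDiagram.mem_cells]
  simp only [frobenius, Finset.mem_biUnion, Finset.mem_univ, true_and, Finset.mem_union,
    Finset.mem_image, Finset.mem_range, Prod.mk.injEq]
  refine exists_congr fun i => ⟨?_, ?_⟩
  · rintro (⟨s, hs, rfl, rfl⟩ | ⟨s, hs, rfl, rfl⟩)
    · exact ⟨by omega, by omega, by omega⟩
    · exact ⟨by omega, by omega, by omega⟩
  · rintro ⟨hi, ha, hb⟩
    rcases le_total a b with h | h
    · exact Or.inl ⟨b - a, by omega, by omega, by omega⟩
    · exact Or.inr ⟨a - b, by omega, by omega, by omega⟩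

theorem rowLen_frobenius (i : Fin n) : (frobenius k l hk hl).rowLen i = k i + i + 1 := by
  refine eq_of_forall_lt_iff fun b => ?_
  rw [← YoungDiagram.mem_iff_lt_rowLen, mem_frobenius]
  constructor
  · rintro ⟨j, hj, h1, h2⟩
    rcases le_total (i : ℕ) b with h | h
    · obtain rfl : j = i := Fin.ext (by omega)
      omega
    · omega
  · intro hb
    rcases le_total (i : ℕ) b with h | h
    · exact ⟨i, by omega, by omega, by omega⟩
    · refine ⟨⟨b, by omega⟩, by simp [h], ?_, by simp⟩
      have := add_le_of_strictAnti hl (show (⟨b, by omega⟩ : Fin n) ≤ i from Fin.le_def.2 h)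
      simp only at this ⊢
      omega

/-- The row of a partition that corresponds to a number `m` that is not among the `l_i`. -/
theorem rowLen_frobenius_of_lt {m j : ℕ} (hj : j ≤ n) (h1 : ∀ i : Fin n, (i : ℕ) < j → m < l i)
    (h2 : ∀ i : Fin n, j ≤ i → l i < m) : (frobenius k l hk hl).rowLen (m + j) = j := by
  refine eq_of_forall_lt_iff fun b => ?_
  rw [← YoungDiagram.mem_iff_lt_rowLen, mem_frobenius]
  constructor
  · rintro ⟨i, hi, h3, h4⟩
    by_contra hb
    rcases lt_or_ge (i : ℕ) j with hij | hij
    · omega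
    · have h5 := h2 ⟨j, by omega⟩ le_rfl
      have h6 := add_le_of_strictAnti hl (show (⟨j, by omega⟩ : Fin n) ≤ i from Fin.le_def.2 hij)
      simp only at h5 h6
      omega
  · intro hb
    refine ⟨⟨b, by omega⟩, by simp; omega, ?_, by simp⟩
    have h3 := add_le_of_strictAnti hl
      (show (⟨b, by omega⟩ : Fin n) ≤ ⟨j - 1, by omega⟩ from Fin.le_def.2 (by simp; omega))
    have h4 := h1 ⟨j - 1, by omega⟩ (by simp; omega)
    simp only at h3 h4 ⊢
    omega

/-- The row is found with `j` the number of `l_i` that exceed `m`; strict decrease gives `m + j ≤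
l_1 ≤ N` when `j > 0`. -/
theorem exists_rowLen_frobenius {m N : ℕ} (hm : m ∉ Set.range l) (hN : ∀ i, l i ≤ N)
    (hmN : m ≤ N) : ∃ j : ℕ, m + j ≤ N ∧ (frobenius k l hk hl).rowLen (m + j) = j := by
  have hex : ∃ j : ℕ, ∀ i : Fin n, j ≤ i → l i < m := ⟨n, fun i hi => absurd i.2 (by omega)⟩
  classical
  set j := Nat.find hex with hj
  have hjn : j ≤ n := Nat.find_min' hex fun i hi => absurd i.2 (by omega)
  have h2 : ∀ i : Fin n, j ≤ i → l i < m := Nat.find_spec hex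
  have h1 : ∀ i : Fin n, (i : ℕ) < j → m < l i := by
    intro i hi
    have h3 := Nat.find_min hex hi
    push Not at h3
    obtain ⟨i', h4, h5⟩ := h3
    have h6 : l i' ≤ l i := hl.antitone (Fin.le_def.2 h4)
    have h7 : m ≠ l i := fun h => hm ⟨i, h.symm⟩
    omega
  refine ⟨j, ?_, rowLen_frobenius_of_lt hk hl hjn h1 h2⟩
  rcases Nat.eq_zero_or_pos j with h0 | h0
  · omega
  · have h3 := add_le_of_strictAnti hl
      (show (⟨0, by omega⟩ : Fin n) ≤ ⟨j - 1, by omega⟩ from Fin.le_def.2 (by simp))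
    have h4 := h1 ⟨j - 1, by omega⟩ (by simp; omega)
    have h5 := hN ⟨0, by omega⟩
    simp only at h3 h4 h5
    omega

/-- The levels of `(k | l)`. -/
theorem range_lev_frobenius {N : ℕ} (hN : ∀ i, l i ≤ N) :
    Set.range (lev (frobenius k l hk hl) (N + 1)) =
      Set.range (fun i => N + 1 + k i) ∪ {m | m ≤ N ∧ N - m ∉ Set.range l} := by
  classical
  set T : Finset ℕ := Finset.univ.image (fun i => N + 1 + k i) ∪
    (Finset.range (N + 1) \ Finset.univ.image fun i => N - l i) with hT
  have hTset : (T : Set ℕ) =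
      Set.range (fun i => N + 1 + k i) ∪ {m | m ≤ N ∧ N - m ∉ Set.range l} := by
    ext m
    simp only [hT, Finset.coe_union, Finset.coe_image, Finset.coe_univ, Set.image_univ,
      Finset.coe_sdiff, Finset.coe_range, Set.mem_union, Set.mem_sdiff, Set.mem_Iio, Set.mem_range,
      Set.mem_ofPred_eq, not_exists, Nat.lt_succ_iff]
    refine or_congr_right (and_congr_right fun hm => forall_congr' fun i => not_congr ?_)
    have := hN i
    omega
  -- One inclusion suffices, since both sets have `N + 1` elements: the `k_i` give the levels above
  -- `N`, and the `l_i` give the gaps `N - l_i` below.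
  have hsub : T ⊆ Finset.univ.image (lev (frobenius k l hk hl) (N + 1)) := by
    rw [← Finset.coe_subset, hTset]
    rintro m (⟨i, rfl⟩ | ⟨hm, hml⟩)
    · have hi : (i : ℕ) < N + 1 := by
        have h3 := add_le_of_strictAnti hl
          (show (⟨0, by have := i.2; omega⟩ : Fin n) ≤ i from Fin.le_def.2 (by simp))
        have h5 := hN ⟨0, by have := i.2; omega⟩
        simp only at h3 h5
        omega
      refine Finset.mem_coe.2 (Finset.mem_image.2 ⟨⟨i, hi⟩, Finset.mem_univ _, ?_⟩)
      simp only [lev, rowLen_frobenius]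
      omega
    · obtain ⟨j, hj, hj'⟩ := exists_rowLen_frobenius hk hl hml hN (Nat.sub_le _ _)
      refine Finset.mem_coe.2 (Finset.mem_image.2 ⟨⟨N - m + j, by omega⟩, Finset.mem_univ _, ?_⟩)
      simp only [lev, hj']
      omega
  have hcard : T.card = N + 1 := by
    rw [hT, Finset.card_union_of_disjoint, Finset.card_sdiff_of_subset,
      Finset.card_image_of_injective, Finset.card_image_of_injOn]
    · simp only [Finset.card_univ, Fintype.card_fin, Finset.card_range]
      have : n ≤ N + 1 := by
        rcases Nat.eq_zero_or_pos n with h0 | h0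
        · omega
        · have h3 := add_le_of_strictAnti hl
            (show (⟨0, h0⟩ : Fin n) ≤ ⟨n - 1, by omega⟩ from Fin.le_def.2 (by simp))
          have h5 := hN ⟨0, by omega⟩
          simp only at h3 h5
          omega
      omega
    · intro i _ j _ h
      have h1 := hN i
      have h2 := hN j
      simp only at h
      exact hl.injective (by omega)
    · intro i j h
      exact hk.injective (by simpa using h)
    · intro m hm
      obtain ⟨i, _, rfl⟩ := Finset.mem_image.1 hm
      exact Finset.mem_range.2 (by omega)
    · rw [Finset.disjoint_left]
      intro m hm hm'
      obtain ⟨i, _, rfl⟩ := Finset.mem_image.1 hm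
      have := Finset.mem_range.1 (Finset.mem_sdiff.1 hm').1
      omega
  have heq := Finset.eq_of_subset_of_card_le hsub (by
    rw [hcard, Finset.card_image_of_injective _ (strictAnti_lev _ _).injective, Finset.card_univ,
      Fintype.card_fin])
  rw [← hTset, heq]
  simp

theorem frobenius_zero {k l : Fin 0 → ℕ} (hk : StrictAnti k) (hl : StrictAnti l) :
    frobenius k l hk hl = ⊥ := by
  ext ⟨a, b⟩
  rw [YoungDiagram.mem_cells, YoungDiagram.mem_cells, mem_frobenius]
  simp

theorem lt_colLen_frobenius (i : Fin n) : l i < (frobenius k l hk hl).colLen 0 := by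
  have h : ((i : ℕ) + l i, (i : ℕ)) ∈ frobenius k l hk hl :=
    (mem_frobenius hk hl).2 ⟨i, by omega, by omega, by omega⟩
  exact YoungDiagram.mem_iff_lt_colLen.1
    ((frobenius k l hk hl).up_left_mem (Nat.le_add_left _ _) (Nat.zero_le _) h)

/-- Every partition can be written in Frobenius notation. -/
theorem exists_eq_frobenius (lam : YoungDiagram) : ∃ (n : ℕ) (k l : Fin n → ℕ)
    (hk : StrictAnti k) (hl : StrictAnti l), lam = frobenius k l hk hl := by
  classical
  have hex : ∃ i, (i, i) ∉ lam := ⟨lam.colLen 0, fun h =>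
    lt_irrefl _ (YoungDiagram.mem_iff_lt_colLen.1 (lam.up_left_mem le_rfl (Nat.zero_le _) h))⟩
  have hn : ∀ i, i < Nat.find hex ↔ (i, i) ∈ lam := by
    intro i
    constructor
    · intro h
      simpa using Nat.find_min hex h
    · intro h
      by_contra hi
      push Not at hi
      exact Nat.find_spec hex (lam.up_left_mem hi hi h)
  have hr : ∀ i : Fin (Nat.find hex), (i : ℕ) < lam.rowLen i := fun i =>
    YoungDiagram.mem_iff_lt_rowLen.1 ((hn i).1 i.2)
  have hc : ∀ i : Fin (Nat.find hex), (i : ℕ) < lam.colLen i := fun i =>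
    YoungDiagram.mem_iff_lt_colLen.1 ((hn i).1 i.2)
  have hk : StrictAnti fun i : Fin (Nat.find hex) => lam.rowLen i - i - 1 := by
    intro i j hij
    have h1 := lam.rowLen_anti i j (Fin.le_def.1 hij.le)
    have h2 := hr j
    have h3 := Fin.lt_def.1 hij
    simp only
    omega
  have hl : StrictAnti fun i : Fin (Nat.find hex) => lam.colLen i - i - 1 := by
    intro i j hij
    have h1 := lam.colLen_anti i j (Fin.le_def.1 hij.le)
    have h2 := hc j
    have h3 := Fin.lt_def.1 hij
    simp only
    omega
  refine ⟨Nat.find hex, _, _, hk, hl, ?_⟩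
  · ext ⟨a, b⟩
    rw [YoungDiagram.mem_cells, YoungDiagram.mem_cells, mem_frobenius]
    constructor
    · intro h
      have hi := lam.up_left_mem (min_le_left a b) (min_le_right a b) h
      refine ⟨⟨min a b, (hn _).2 hi⟩, rfl, ?_, ?_⟩
      · have h1 := YoungDiagram.mem_iff_lt_colLen.1
          (lam.up_left_mem le_rfl (min_le_right a b) h)
        simp only
        omega
      · have h1 := YoungDiagram.mem_iff_lt_rowLen.1
          (lam.up_left_mem (min_le_left a b) le_rfl h)
        simp only
        omega
    · rintro ⟨i, hi, h1, h2⟩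
      have h3 := hr i
      have h4 := hc i
      rcases le_total a b with h | h
      · rw [min_eq_left h] at hi
        rw [YoungDiagram.mem_iff_lt_rowLen, ← hi]
        omega
      · rw [min_eq_right h] at hi
        rw [YoungDiagram.mem_iff_lt_colLen, ← hi]
        omega

end Frobenius

/-! ### Expansion along the first row of Frobenius notation -/

theorem colLen_frobenius_le {n N : ℕ} {k l : Fin n → ℕ} (hk : StrictAnti k) (hl : StrictAnti l)
    (hN : ∀ i, l i ≤ N) : (frobenius k l hk hl).colLen 0 ≤ N + 1 := by
  rw [← not_lt, ← YoungDiagram.mem_iff_lt_colLen, mem_frobenius]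
  rintro ⟨i, hi, h1, -⟩
  have := hN i
  omega

section FirstRow

variable {n N : ℕ} {k l : Fin (n + 1) → ℕ} (hk : StrictAnti k) (hl : StrictAnti l)

/-- The partition obtained from `(k | l)` by deleting `k_1` and `l_j`. -/
def removeHook (j : Fin (n + 1)) : YoungDiagram :=
  frobenius (k ∘ Fin.succ) (j.removeNth l) (hk.comp_strictMono (Fin.strictMono_succ))
    (strictAnti_removeNth hl j)

/-- The levels of `(k | l)` without the largest one. -/
def levTail (N : ℕ) : Fin N → ℕ :=
  (0 : Fin (N + 1)).removeNth (lev (frobenius k l hk hl) (N + 1))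

theorem strictAnti_levTail : StrictAnti (levTail hk hl N) :=
  strictAnti_removeNth (strictAnti_lev _ _) 0

theorem lev_frobenius_zero : lev (frobenius k l hk hl) (N + 1) 0 = N + 1 + k 0 := by
  have h := rowLen_frobenius hk hl 0
  simp only [Fin.val_zero] at h
  simp only [lev, Fin.val_zero, h]
  omega

theorem cons_levTail : (Fin.cons (N + 1 + k 0) (levTail hk hl N) : Fin (N + 1) → ℕ) =
    lev (frobenius k l hk hl) (N + 1) := by
  rw [← lev_frobenius_zero hk hl]
  exact Fin.cons_self_tail _

theorem range_removeNth {M : ℕ} {t : Fin (M + 1) → ℕ} (ht : StrictAnti t) (i : Fin (M + 1)) :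
    Set.range (i.removeNth t : Fin M → ℕ) = Set.range t \ {t i} := by
  rw [range_eq_insert t i, Set.insert_sdiff_self_of_notMem (apply_notMem_range_removeNth ht i)]

theorem range_levTail (hN : ∀ i, l i ≤ N) : Set.range (levTail hk hl N) =
    Set.range (fun i : Fin n => N + 1 + k i.succ) ∪ {m | m ≤ N ∧ N - m ∉ Set.range l} := by
  rw [levTail, range_removeNth (strictAnti_lev _ _), range_lev_frobenius hk hl hN,
    lev_frobenius_zero]
  ext m
  simp only [Set.mem_sdiff, Set.mem_union, Set.mem_range, Set.mem_ofPred_eq, Set.mem_singleton_iff]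
  constructor
  · rintro ⟨⟨i, rfl⟩ | h, hm⟩
    · obtain ⟨i', rfl⟩ := Fin.exists_succ_eq.2 (show i ≠ 0 from fun h => hm (by rw [h]))
      exact Or.inl ⟨i', rfl⟩
    · exact Or.inr h
  · rintro (⟨i, rfl⟩ | h)
    · refine ⟨Or.inl ⟨_, rfl⟩, fun h => ?_⟩
      have := hk (Fin.succ_pos i)
      omega
    · exact ⟨Or.inr h, by omega⟩

theorem ins_levTail_of_notMem (D : (Fin (N + 1) → ℕ) → ℂ) (hN : ∀ i, l i ≤ N) {m : ℕ} (hm : m ≤ N)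
    (hml : m ∉ Set.range l) : ins D (N - m) (levTail hk hl N) = 0 := by
  refine ins_of_mem D ?_
  rw [range_levTail hk hl hN]
  exact Or.inr ⟨Nat.sub_le _ _, by rwa [Nat.sub_sub_self hm]⟩

/-- Inserting `N - l_j` fills the gap due to `l_j`, which deletes `l_j` from the Frobenius notation.
The new level stands at position `l_j + j` (counted from zero), and this is the source of the sign.
-/
theorem ins_levTail (D : (Fin (N + 1) → ℕ) → ℂ) (hN : ∀ i, l i ≤ N) (j : Fin (n + 1)) :
    ins D (N - l j) (levTail hk hl N) =
      (-1) ^ (l j + j : ℕ) * D (lev (removeHook hk hl j) (N + 1)) := by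
  have hq : l j + j ≤ N := by
    have h1 := add_le_of_strictAnti hl (Fin.zero_le j)
    have h2 := hN 0
    simp only [Fin.val_zero] at h1
    omega
  have hrow : (removeHook hk hl j).rowLen (l j + j) = j := by
    refine rowLen_frobenius_of_lt _ _ (by omega) (fun i hi => ?_) fun i hi => ?_
    · refine hl ?_
      rw [Fin.succAbove_of_castSucc_lt _ _ (Fin.lt_def.2 (by simpa using hi))]
      exact Fin.lt_def.2 (by simpa using hi)
    · refine hl ?_
      rw [Fin.succAbove_of_le_castSucc _ _ (Fin.le_def.2 (by simpa using hi))]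
      exact Fin.lt_def.2 (by simp; omega)
  set s := lev (removeHook hk hl j) (N + 1) with hs
  have hsa : StrictAnti s := strictAnti_lev _ _
  have hsq : s ⟨l j + j, by omega⟩ = N - l j := by
    simp only [hs, lev, hrow]
    omega
  have htail : (Fin.removeNth ⟨l j + j, by omega⟩ s : Fin N → ℕ) = levTail hk hl N := by
    refine strictAnti_unique (strictAnti_removeNth hsa _) (strictAnti_levTail hk hl) ?_
    rw [range_removeNth hsa, hsq, hs, removeHook, range_lev_frobenius (l := j.removeNth l) _ _ fun i => hN _,
      range_levTail hk hl hN]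
    ext m
    simp only [Set.mem_sdiff, Set.mem_union, Set.mem_range, Set.mem_ofPred_eq,
      Set.mem_singleton_iff, Function.comp_apply]
    constructor
    · rintro ⟨h | ⟨h1, h2⟩, hm⟩
      · exact Or.inl h
      · refine Or.inr ⟨h1, ?_⟩
        rintro ⟨i, hi⟩
        rcases eq_or_ne i j with rfl | hij
        · omega
        · obtain ⟨i', rfl⟩ := Fin.exists_succAbove_eq hij
          exact h2 ⟨i', hi⟩
    · rintro (⟨i, rfl⟩ | ⟨h1, h2⟩)
      · exact ⟨Or.inl ⟨i, rfl⟩, by omega⟩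
      · refine ⟨Or.inr ⟨h1, ?_⟩, ?_⟩
        · rintro ⟨i, hi⟩
          exact h2 ⟨_, hi⟩
        · rintro rfl
          exact h2 ⟨j, (Nat.sub_sub_self (hN j)).symm⟩
  rw [← hsq, ← htail, ins_removeNth D hsa]

/-- Only gaps survive in the sum, as inserting an existing level gives zero. The two factors
`(-1)^{l_j}` cancel and leave the sign of a first row expansion. -/
theorem sum_ins_levTail (D : (Fin (N + 1) → ℕ) → ℂ) (H : ℕ → ℂ) (hN : ∀ i, l i ≤ N) :
    ∑ i : Fin (N + 1), (-1) ^ (i : ℕ) * H i * ins D (N - i) (levTail hk hl N) =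
      ∑ j : Fin (n + 1), (-1) ^ (j : ℕ) * H (l j) * D (lev (removeHook hk hl j) (N + 1)) := by
  symm
  refine Finset.sum_of_injOn (fun j => (⟨l j, Nat.lt_succ_of_le (hN j)⟩ : Fin (N + 1))) ?_ ?_ ?_ ?_
  · intro i _ j _ h
    exact hl.injective (Fin.mk.inj h)
  · intro j _
    exact Finset.mem_coe.2 (Finset.mem_univ _)
  · intro i _ hi
    rw [ins_levTail_of_notMem hk hl D hN (Nat.le_of_lt_succ i.2), mul_zero]
    rintro ⟨j, hj⟩
    exact hi ⟨j, Finset.mem_coe.2 (Finset.mem_univ _), Fin.ext hj⟩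
  · intro j _
    have h : ((-1 : ℂ) ^ l j) * (-1) ^ l j = 1 := by
      rw [← pow_add, ← two_mul, pow_mul]
      simp
    rw [ins_levTail hk hl D hN, pow_add]
    linear_combination (-((-1) ^ (j : ℕ) * H (l j) * D (lev (removeHook hk hl j) (N + 1)))) * h

end FirstRow

/-- A function on partitions that has a first row expansion is given by Giambelli's formula. -/
theorem eq_det_of_removeHook (E : YoungDiagram → ℂ) (H : ℕ → ℕ → ℂ) (N : ℕ) (h0 : E ⊥ = 1)
    (hE : ∀ (n : ℕ) (k l : Fin (n + 1) → ℕ) (hk : StrictAnti k) (hl : StrictAnti l),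
      (∀ i, l i ≤ N) → E (frobenius k l hk hl) =
        ∑ j : Fin (n + 1), (-1) ^ (j : ℕ) * H (k 0) (l j) * E (removeHook hk hl j))
    {n : ℕ} {k l : Fin n → ℕ} (hk : StrictAnti k) (hl : StrictAnti l) (hN : ∀ i, l i ≤ N) :
    E (frobenius k l hk hl) = Matrix.det (Matrix.of fun i j => H (k i) (l j)) := by
  induction n with
  | zero => rw [frobenius_zero, h0, Matrix.det_isEmpty]
  | succ n ih =>
    rw [hE n k l hk hl hN, Matrix.det_succ_row_zero]
    refine Finset.sum_congr rfl fun j _ => ?_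
    rw [removeHook, ih (l := j.removeNth l) _ _ fun i => hN _]
    rfl

/-! ### Solutions of the KP hierarchy satisfy the Giambelli type formula -/

section Forward

variable {τ : MvPowerSeries ℕ ℂ} {c : YoungDiagram → ℂ}

theorem eq_lev_bot (N : ℕ) : (fun i : Fin (N + 1) => N - (i : ℕ)) = lev ⊥ (N + 1) := by
  funext i
  have h : (⊥ : YoungDiagram).rowLen i = 0 := by
    by_contra h
    exact YoungDiagram.notMem_bot _ (YoungDiagram.mem_iff_lt_rowLen.2 (Nat.pos_of_ne_zero h))
  simp [lev, h]

theorem colLen_bot : (⊥ : YoungDiagram).colLen 0 = 0 := by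
  by_contra h
  exact YoungDiagram.notMem_bot _ (YoungDiagram.mem_iff_lt_colLen.2 (Nat.pos_of_ne_zero h))

theorem strictAnti_cons_lev_bot (N a : ℕ) :
    StrictAnti (Fin.cons (N + 1 + a) (lev ⊥ (N + 1)) : Fin (N + 2) → ℕ) := by
  refine Fin.strictAnti_iff_succ_lt.2 fun i => ?_
  rw [← eq_lev_bot]
  refine Fin.cases ?_ (fun i => ?_) i
  · simp
    omega
  · rw [Fin.cons_succ, Fin.castSucc_succ, Fin.cons_succ]
    simp
    omega

/-- Raising the level `N - b` of the empty partition to `N + 1 + a` gives the hook `(a | b)`. The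
`succ` accounts for the new level at the front. -/
theorem lev_hook {N : ℕ} (a : ℕ) (b : Fin (N + 1)) :
    (b.succ.removeNth (Fin.cons (N + 1 + a) (lev ⊥ (N + 1)) : Fin (N + 2) → ℕ) :
      Fin (N + 1) → ℕ) = lev (hook a b) (N + 1) := by
  have hanti := strictAnti_cons_lev_bot N a
  refine strictAnti_unique (strictAnti_removeNth hanti _) (strictAnti_lev _ _) ?_
  rw [range_removeNth hanti, hook, range_lev_frobenius _ _ fun _ => Nat.le_of_lt_succ b.2,
    Fin.range_cons, Fin.cons_succ, ← eq_lev_bot]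
  ext m
  simp only [Set.mem_sdiff, Set.mem_union, Set.mem_range, Set.mem_ofPred_eq, Set.mem_insert_iff,
    Set.mem_singleton_iff, exists_const]
  constructor
  · rintro ⟨rfl | ⟨i, rfl⟩, h⟩
    · exact Or.inl rfl
    · exact Or.inr ⟨by omega, by omega⟩
  · rintro (rfl | ⟨h1, h2⟩)
    · exact ⟨Or.inl rfl, by omega⟩
    · exact ⟨Or.inr ⟨⟨N - m, by omega⟩, by simp; omega⟩, by omega⟩

/-- The Plücker relation has one term in which the new level `N + 1 + k_1` moves to `β`, giving `c ⊥
· c λ`. In the others a level of the empty partition moves: it leaves a hook behind in `α` and fills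
a gap in `β`. -/
theorem eq_sum_removeHook (hc : IsSchurExpansion τ c) (h : IsKPSolution τ) (h0 : c ⊥ = 1) {n : ℕ}
    {k l : Fin (n + 1) → ℕ} (hk : StrictAnti k) (hl : StrictAnti l) :
    c (frobenius k l hk hl) =
      ∑ j : Fin (n + 1), (-1) ^ (j : ℕ) * c (hook (k 0) (l j)) * c (removeHook hk hl j) := by
  set lam := frobenius k l hk hl with hlam
  set N := lam.card with hN
  have hcol : lam.colLen 0 ≤ N := colLen_le_card lam
  have hlN : ∀ i, l i ≤ N := fun i => (lt_colLen_frobenius hk hl i).le.trans hcol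
  have hpos : 0 < N := by
    have : l 0 < lam.colLen 0 := lt_colLen_frobenius hk hl 0
    omega
  set α : Fin (N + 2) → ℕ := Fin.cons (N + 1 + k 0) (lev ⊥ (N + 1)) with hα
  have hαanti : StrictAnti α := strictAnti_cons_lev_bot N (k 0)
  -- Moving the level `N + 1 + k_1` from one tuple to the other preserves the total, so the weight
  -- is `|λ| = N`, just within the range where the relations are available.
  have hsum : ∑ i, α i + ∑ i, levTail hk hl N i = (N - 1) + 1 + 2 * vacSum (N + 1) := by
    have h1 := sum_lev (hcol.trans (Nat.le_succ N))
    have h2 := sum_removeNth (lev lam (N + 1)) 0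
    have h3 := lev_frobenius_zero (N := N) hk hl
    have h4 := sum_lev (colLen_bot.le.trans (Nat.zero_le (N + 1)))
    rw [← hlam] at h3
    rw [hα, Fin.sum_univ_succ]
    simp only [Fin.cons_zero, Fin.cons_succ]
    rw [show levTail hk hl N = (0 : Fin (N + 1)).removeNth (lev lam (N + 1)) from rfl]
    rw [show (⊥ : YoungDiagram).card = 0 from rfl] at h4
    simp only [vacSum, Nat.succ_eq_add_one] at *
    omega
  have hP := pluckerSum_eq_zero hc h (Nat.sub_le N 1) hαanti (strictAnti_levTail hk hl) hsum
  rw [pluckerSum, Fin.sum_univ_succ] at hP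
  have hz : ins (fun t => c (diag t)) (α 0) (levTail hk hl N) = c lam := by
    have h1 := ins_removeNth (fun t => c (diag t)) (strictAnti_lev lam (N + 1)) 0
    rw [lev_frobenius_zero hk hl] at h1
    rw [hα, Fin.cons_zero, levTail, h1, diag_lev (hcol.trans (Nat.le_succ N))]
    simp
  have hz' : diag ((0 : Fin (N + 2)).removeNth α : Fin (N + 1) → ℕ) = ⊥ := by
    have : ((0 : Fin (N + 2)).removeNth α : Fin (N + 1) → ℕ) = lev ⊥ (N + 1) := Fin.tail_cons _ _
    rw [this, diag_lev (colLen_bot.le.trans (Nat.zero_le _))]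
  have hs : ∀ i : Fin (N + 1), c (diag (i.succ.removeNth α : Fin (N + 1) → ℕ)) =
      c (hook (k 0) i) := by
    intro i
    rw [hα, lev_hook, hook, diag_lev (colLen_frobenius_le _ _ fun _ => Nat.le_of_lt_succ i.2)]
  have hαs : ∀ i : Fin (N + 1), α i.succ = N - i := fun i => by
    rw [hα, Fin.cons_succ, ← eq_lev_bot]
  have hl2 := sum_ins_levTail hk hl (fun t => c (diag t)) (c ∘ hook (k 0)) hlN
  have hrem : ∀ j, c (diag (lev (removeHook hk hl j) (N + 1))) = c (removeHook hk hl j) := by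
    intro j
    rw [removeHook, diag_lev (colLen_frobenius_le (l := j.removeNth l) _ _ fun i => hlN _)]
  simp only [hz, hz', hs, hαs, h0, Fin.val_zero, pow_zero, Fin.val_succ, one_mul] at hP
  simp only [hrem, Function.comp_apply] at hl2
  rw [← hl2, ← sub_eq_zero, ← hP, sub_eq_add_neg, ← Finset.sum_neg_distrib]
  congr 1
  refine Finset.sum_congr rfl fun i _ => ?_
  ring

theorem isGiambelli_of_isKPSolution (hc : IsSchurExpansion τ c) (h : IsKPSolution τ)
    (h0 : c ⊥ = 1) : IsGiambelli c := by
  intro n k l hk hl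
  exact eq_det_of_removeHook c (fun a b => c (hook a b)) (∑ i, l i) h0
    (fun n k l hk hl _ => eq_sum_removeHook hc h h0 hk hl) hk hl
    fun i => Finset.single_le_sum (fun _ _ => Nat.zero_le _) (Finset.mem_univ i)

end Forward

/-! ### Determinants satisfy the Plücker relations -/

section Backward

variable {N : ℕ} (G : ℕ → Fin (N + 1) → ℂ)

/-- The determinant with rows `G (t 0), G (t 1), …`. -/
def rowDet (t : Fin (N + 1) → ℕ) : ℂ := Matrix.det (Matrix.of fun a => G (t a))

/-- The minors of the rows `G (β 0), G (β 1), …`. -/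
def rowMinor (β : Fin N → ℕ) (j : Fin (N + 1)) : ℂ :=
  Matrix.det (Matrix.of fun a b : Fin N => G (β a) (j.succAbove b))

theorem rowDet_cons (m : ℕ) (β : Fin N → ℕ) : rowDet G (Fin.cons m β) =
    ∑ j : Fin (N + 1), (-1) ^ (j : ℕ) * G m j * rowMinor G β j := by
  rw [rowDet, Matrix.det_succ_row_zero]
  rfl

theorem ins_rowDet {β : Fin N → ℕ} (hβ : StrictAnti β) (m : ℕ) :
    ins (rowDet G) m β = rowDet G (Fin.cons m β) := by
  by_cases hm : m ∈ Set.range β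
  · rw [ins_of_mem _ hm]
    obtain ⟨j, rfl⟩ := hm
    refine (Matrix.det_zero_of_row_eq (i := 0) (j := j.succ) (Fin.succ_ne_zero j).symm ?_).symm
    funext k
    simp
  · obtain ⟨s, i, hs, rfl, rfl⟩ := exists_insert hβ hm
    rw [ins_removeNth _ hs, rowDet, rowDet, det_cons_removeNth]

theorem sum_mul_rowDet_removeNth (α : Fin (N + 2) → ℕ) (j : Fin (N + 1)) :
    ∑ i : Fin (N + 2), (-1) ^ (i : ℕ) * G (α i) j * rowDet G (i.removeNth α) = 0 := by
  have h : Matrix.det (Matrix.of fun a : Fin (N + 2) =>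
      (Fin.cons (G (α a) j) (G (α a)) : Fin (N + 2) → ℂ)) = 0 :=
    Matrix.det_zero_of_column_eq (i := 0) (j := j.succ) (Fin.succ_ne_zero j).symm fun a => by simp
  rw [Matrix.det_succ_column_zero] at h
  exact h

/-- Expand the second factor along the row of level `α i`. The sum over `i` then becomes, for each
column `j`, an `(N + 2)`-rowed determinant in which column `j` occurs twice. -/
theorem pluckerSum_rowDet (α : Fin (N + 2) → ℕ) {β : Fin N → ℕ} (hβ : StrictAnti β) :
    pluckerSum (rowDet G) α β = 0 := by
  have h : pluckerSum (rowDet G) α β = ∑ j : Fin (N + 1), (-1) ^ (j : ℕ) * rowMinor G β j *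
      ∑ i : Fin (N + 2), (-1) ^ (i : ℕ) * G (α i) j * rowDet G (i.removeNth α) := by
    simp only [pluckerSum, ins_rowDet G hβ, rowDet_cons, Finset.mul_sum]
    rw [Finset.sum_comm]
    refine Finset.sum_congr rfl fun j _ => Finset.sum_congr rfl fun i _ => ?_
    ring
  simp only [h, sum_mul_rowDet_removeNth, mul_zero, Finset.sum_const_zero]

/-- The matrix with rows indexed by levels whose minors are the coefficients of a Schur expansion
that satisfies the Giambelli type formula. -/
def giambelliRow (c : YoungDiagram → ℂ) (m : ℕ) (j : Fin (N + 1)) : ℂ :=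
  if m ≤ N then (if (j : ℕ) = N - m then 1 else 0) else (-1) ^ (j : ℕ) * c (hook (m - N - 1) j)

theorem rowDet_cons_sub (c : YoungDiagram → ℂ) (β : Fin N → ℕ) (i : Fin (N + 1)) :
    rowDet (giambelliRow c) (Fin.cons (N - i : ℕ) β) =
      (-1) ^ (i : ℕ) * rowMinor (giambelliRow c) β i := by
  rw [rowDet_cons, Finset.sum_eq_single i]
  · rw [giambelliRow, if_pos (Nat.sub_le _ _), if_pos (by omega), mul_one]
  · intro j _ hj
    rw [giambelliRow, if_pos (Nat.sub_le _ _), if_neg fun h => hj (Fin.ext (by omega)), mul_zero,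
      zero_mul]
  · exact fun h => absurd (Finset.mem_univ _) h

theorem rowDet_lev_bot (c : YoungDiagram → ℂ) :
    rowDet (giambelliRow (N := N) c) (lev ⊥ (N + 1)) = 1 := by
  rw [rowDet, ← Matrix.det_one (n := Fin (N + 1))]
  congr 1
  ext i j
  rw [← eq_lev_bot, Matrix.of_apply, giambelliRow, if_pos (Nat.sub_le _ _), Matrix.one_apply]
  refine if_congr ?_ rfl rfl
  rw [Fin.ext_iff]
  simp only
  omega

/-- Expand along the top row, whose entries are signed hook coefficients. Up to sign, each cofactor
is the determinant with the unit row of level `N - i` on top, that is, with that level inserted into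
the tail. -/
theorem rowDet_lev_frobenius (c : YoungDiagram → ℂ) {n : ℕ} {k l : Fin (n + 1) → ℕ}
    (hk : StrictAnti k) (hl : StrictAnti l) (hN : ∀ i, l i ≤ N) :
    rowDet (giambelliRow (N := N) c) (lev (frobenius k l hk hl) (N + 1)) =
      ∑ j : Fin (n + 1), (-1) ^ (j : ℕ) * c (hook (k 0) (l j)) *
        rowDet (giambelliRow (N := N) c) (lev (removeHook hk hl j) (N + 1)) := by
  rw [← sum_ins_levTail hk hl (rowDet (giambelliRow c)) (fun b => c (hook (k 0) b)) hN,
    ← cons_levTail, rowDet_cons]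
  refine Finset.sum_congr rfl fun i _ => ?_
  rw [ins_rowDet _ (strictAnti_levTail hk hl), rowDet_cons_sub, giambelliRow, if_neg (by omega),
    show N + 1 + k 0 - N - 1 = k 0 by omega]
  ring

/-- The minors obey the first row recursion with value 1 at the empty partition, so they are the
same determinants of hook coefficients that `IsGiambelli` prescribes for `c`. -/
theorem diag_eq_rowDet {c : YoungDiagram → ℂ} (hG : IsGiambelli c) {t : Fin (N + 1) → ℕ}
    (ht : StrictAnti t) : c (diag t) = rowDet (giambelliRow c) t := by
  obtain ⟨n, k, l, hk, hl, h⟩ := exists_eq_frobenius (diag t)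
  have hN : ∀ i, l i ≤ N := fun i => by
    have h1 := lt_colLen_frobenius hk hl i
    have h2 := colLen_diag_le ht
    rw [← h] at h1
    omega
  have h1 := eq_det_of_removeHook (fun lam => rowDet (giambelliRow c) (lev lam (N + 1)))
    (fun a b => c (hook a b)) N (rowDet_lev_bot c)
    (fun n k l hk hl hN => rowDet_lev_frobenius c hk hl hN) hk hl hN
  rw [← hG n k l hk hl, ← h, lev_diag ht] at h1
  exact h1.symm

theorem ins_congr {c c' : (Fin (N + 1) → ℕ) → ℂ} (h : ∀ t, StrictAnti t → c t = c' t) (m : ℕ)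
    {β : Fin N → ℕ} (hβ : StrictAnti β) : ins c m β = ins c' m β := by
  by_cases hm : m ∈ Set.range β
  · rw [ins_of_mem _ hm, ins_of_mem _ hm]
  · obtain ⟨s, i, hs, rfl, rfl⟩ := exists_insert hβ hm
    rw [ins_removeNth _ hs, ins_removeNth _ hs, h s hs]

theorem isKPSolution_of_isGiambelli {τ : MvPowerSeries ℕ ℂ} {c : YoungDiagram → ℂ}
    (hc : IsSchurExpansion τ c) (hG : IsGiambelli c) : IsKPSolution τ := by
  refine isKPSolution_of_pluckerSum hc fun N α β hα hβ => ?_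
  rw [← pluckerSum_rowDet (giambelliRow c) α hβ]
  refine Finset.sum_congr rfl fun i _ => ?_
  dsimp only
  rw [diag_eq_rowDet hG (strictAnti_removeNth hα i),
    ins_congr (fun t ht => diag_eq_rowDet hG ht) _ hβ]

end Backward

/-! ### The constant term of the expansion -/

theorem schur_bot : schur ⊥ = 1 := by
  rw [schur_eq_jdet colLen_bot.le, jdet, Matrix.det_isEmpty]

theorem diagrams_zero : diagrams 0 = {⊥} := by
  ext lam
  rw [mem_diagrams, Finset.mem_singleton]
  constructor
  · intro h
    refine ext_rowLen fun i => ?_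
    have h1 := rowLen_le_card lam i
    have h2 := rowLen_le_card ⊥ i
    rw [show (⊥ : YoungDiagram).card = 0 from rfl] at h2
    omega
  · rintro rfl
    rfl

/-- Only the empty partition has weight zero. This converts `τ(0) = 1` into the normalisation `c ⊥ =
1`, which starts the induction for the Giambelli formula. -/
theorem IsSchurExpansion.apply_bot {τ : MvPowerSeries ℕ ℂ} {c : YoungDiagram → ℂ}
    (hc : IsSchurExpansion τ c) : c ⊥ = MvPowerSeries.constantCoeff τ := by
  have h := isSchurExpansion_iff.1 hc 0
  rw [map_zero, schurPart, diagrams_zero, Finset.sum_singleton, schur_bot] at h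
  rw [← MvPowerSeries.coeff_zero_eq_constantCoeff_apply, h]
  simp

end KP

end

/-- Every formal power series `τ` with `τ(0) = 1` has a unique expansion `τ = ∑_λ ξ_λ χ_λ` in Schur
functions, and `τ` is a solution of the KP hierarchy if and only if the coefficients `ξ_λ` satisfy
the Giambelli type formula. -/
theorem theorem2 (τ : MvPowerSeries ℕ ℂ) (hτ : MvPowerSeries.constantCoeff τ = 1) :
    (∃! c : YoungDiagram → ℂ, KP.IsSchurExpansion τ c) ∧
      ∀ c : YoungDiagram → ℂ, KP.IsSchurExpansion τ c →
        (KP.IsKPSolution τ ↔ KP.IsGiambelli c) := by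
  refine ⟨?_, fun c hc => ⟨fun h => ?_, fun h => ?_⟩⟩
  · obtain ⟨c, hc⟩ := KP.exists_isSchurExpansion τ
    exact ⟨c, hc, fun c' hc' => KP.isSchurExpansion_unique hc' hc⟩
  · exact KP.isGiambelli_of_isKPSolution hc h (hc.apply_bot.trans hτ)
  · exact KP.isKPSolution_of_isGiambelli hc h
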